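/- Let $n\ge 1$, $q\ge 0$ be integers, let $a_0,\dots,a_n:[0,2\pi]\to\mathbb R$ and $c\in\mathbb R^n$, and consider the linear semi-infinite program $$(P)\qquad \min\ c^{\top}x\quad\text{s.t.}\quad \sum_{j=1}^n a_j(t)x_j\le a_0(t)\quad\forall t\in[0,2\pi],\qquad x\in\mathbb R^n,$$ with feasible set $F(P)$, set of optimal solutions $S(P)$ and optimal value $v(P)$. For $k\in\mathbb Z$ put $a_{j,k}=\frac1{2\pi}\int_0^{2\pi}a_j(t)e^{ikt}\,dt=r_{j,k}+i\,s_{j,k}$ with $r_{j,k},s_{j,k}$ real. For $0\le j\le n$ put $\rho_{j,0}=r_{j,0}$, and $\rho_{j,k}=r_{j,k}+r_{j,-k}$, $\varsigma_{j,k}=s_{j,k}-s_{j,-k}$ for $k\ge1$. For an integer $K\ge 0$ let $C_{1,k},C_{2,k}\in\mathbb R^{(K+1)\times(K+1)}$ be the Toeplitz matrices with $(C_{1,k})_{l,m}=1$ if $|l-m|=k$ and $0$ otherwise ($0\le k\le K$), and $(C_{2,k})_{l,m}=1$ if $m-l=k$, $-1$ if $l-m=k$ and $0$ otherwise ($1\le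 k\le K$), and let $$\bar C_{1,k}=\begin{pmatrix}C_{1,k}&0\\0&C_{1,k}\end{pmatrix},\qquad \bar C_{2,k}=\begin{pmatrix}0&-C_{2,k}\\C_{2,k}&0\end{pmatrix}.$$ Let $(TFP_K)$ be the semidefinite program in the variables $x\in\mathbb R^n$ and $Y\in\mathbb R^{2(K+1)\times 2(K+1)}$ symmetric: $$(TFP_K)\qquad \min\ c^{\top}x\quad\text{s.t.}\quad \begin{cases}\operatorname{Tr}(\bar C_{1,k}Y)+\sum_{j=1}^n\rho_{j,k}x_j-\rho_{0,k}=0, & 0\le k\le K,\\ \operatorname{Tr}(\bar C_{2,k}Y)-\sum_{j=1}^n\varsigma_{j,k}x_j+\varsigma_{0,k}=0, & 1\le k\le K,\\ Y\succeq0.\end{cases}$$ Suppose that - (a') each $a_j$, $j=0,\dots,n$, has a $q$-th derivative on $[0,2\pi]$ (one-sided at the end points) that is Lipschitz continuous on $[0,2\pi]$; - (b') $a_j^{(l)}(0)=a_j^{(l)}(2\pi)$ for all $l=0,1,\dots,q$ and $j=0,\dots,n$; - (c) there is $\hat x\in\mathbb R^n$ with $\sum_{j=1}^n a_j(t)\hat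 x_j<a_0(t)$ for all $t\in[0,2\pi]$; - (d) there are $\tilde x\in\mathbb R^n$ and $Q<0$ with $\sum_{j=1}^n a_j(t)\tilde x_j\le Q$ for all $t\in[0,2\pi]$; - (e) $c\ne0$, $S(P)\neq\emptyset$, and there is $R$ with $\|x\|\le R$ for all $x\in S(P)$. Then, for large $K$, the $x$-part of any optimal solution of $(TFP_K)$ is a $\frac{\ln K}{K^{q+1}}$-optimal solution of $(P)$. That is, there are a constant $L>0$ and an integer $K_0$ such that, for every $K\ge K_0$ and every optimal solution $(x^*,Y^*)$ of $(TFP_K)$, $$|c^{\top}x^*-v(P)|\le L\,\frac{\ln K}{K^{q+1}}\qquad\text{and}\qquad d(x^*,F(P))\le L\,\frac{\ln K}{K^{q+1}},$$ where $d$ is the Euclidean distance. -/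

import Mathlib

namespace TrigSIP

/-- The index interval `[0, 2π]` of the semi-infinite constraint. -/
def period : Set ℝ := Set.Icc 0 (2 * Real.pi)

/-- `f` has a `q`-th derivative on `[0, 2π]` (one-sided at the end points), and that derivative is
Lipschitz continuous on `[0, 2π]`. -/
def HasLipschitzDeriv (q : ℕ) (f : ℝ → ℝ) : Prop :=
  (∀ l < q, DifferentiableOn ℝ (iteratedDerivWithin l f period) period) ∧
    ∃ C : NNReal, LipschitzOnWith C (iteratedDerivWithin q f period) period

/-- The derivatives of `f` of orders `0, …, q` take the same values at `0` and at `2π`; for `f` as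
in `HasLipschitzDeriv` this says that the `2π`-periodic extension of `f` is `q` times
differentiable with a Lipschitz `q`-th derivative. -/
def PeriodicDerivs (q : ℕ) (f : ℝ → ℝ) : Prop :=
  ∀ l ≤ q, iteratedDerivWithin l f period 0 = iteratedDerivWithin l f period (2 * Real.pi)

/-- The left-hand side `∑_{j=1}^n a_j(t) x_j` of the constraint. The family `a` collects
`a_0, a_1, …, a_n`. -/
def lhs {n : ℕ} (a : Fin (n + 1) → ℝ → ℝ) (x : EuclideanSpace ℝ (Fin n)) (t : ℝ) : ℝ :=
  ∑ j : Fin n, a j.succ t * x j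

/-- The objective `cᵀ x`. -/
def cost {n : ℕ} (c : Fin n → ℝ) (x : EuclideanSpace ℝ (Fin n)) : ℝ :=
  ∑ j : Fin n, c j * x j

/-- The feasible set `F(P)`. -/
def feasP {n : ℕ} (a : Fin (n + 1) → ℝ → ℝ) : Set (EuclideanSpace ℝ (Fin n)) :=
  {x | ∀ t ∈ period, lhs a x t ≤ a 0 t}

/-- The set `S(P)` of optimal solutions. -/
def solP {n : ℕ} (a : Fin (n + 1) → ℝ → ℝ) (c : Fin n → ℝ) : Set (EuclideanSpace ℝ (Fin n)) :=
  {x | x ∈ feasP a ∧ ∀ y ∈ feasP a, cost c x ≤ cost c y}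

/-- The optimal value `v(P)`. -/
noncomputable def valP {n : ℕ} (a : Fin (n + 1) → ℝ → ℝ) (c : Fin n → ℝ) : ℝ :=
  sInf (cost c '' feasP a)

/-- `x` is an `ε`-optimal solution of `(P)`, with the constant `L`. -/
def IsApproxOptimal {n : ℕ} (a : Fin (n + 1) → ℝ → ℝ) (c : Fin n → ℝ) (L ε : ℝ)
    (x : EuclideanSpace ℝ (Fin n)) : Prop :=
  |cost c x - valP a c| ≤ L * ε ∧ Metric.infDist x (feasP a) ≤ L * ε

/-- The coefficient `(1 / 2π) ∫_0^{2π} f(t) e^{ikt} dt`. -/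
noncomputable def coef (f : ℝ → ℝ) (k : ℤ) : ℂ :=
  1 / (2 * (Real.pi : ℂ)) *
    ∫ t in (0 : ℝ)..(2 * Real.pi), (f t : ℂ) * Complex.exp (Complex.I * (k : ℂ) * (t : ℂ))

/-- `r_0` for `k = 0` and `r_k + r_{-k}` for `k ≥ 1`, where `r_k` is the real part of the `k`-th
coefficient of `f`. These are the entries of `p` (for `a_0`) and of `E` (for `a_1, …, a_n`). -/
noncomputable def cosEntry (f : ℝ → ℝ) (k : ℕ) : ℝ :=
  if k = 0 then (coef f 0).re else (coef f (k : ℤ)).re + (coef f (-(k : ℤ))).re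

/-- `s_k - s_{-k}`, where `s_k` is the imaginary part of the `k`-th coefficient of `f`. These are
the entries of `q` (for `a_0`) and of `F` (for `a_1, …, a_n`). -/
noncomputable def sinEntry (f : ℝ → ℝ) (k : ℕ) : ℝ :=
  (coef f (k : ℤ)).im - (coef f (-(k : ℤ))).im

/-- The symmetric Toeplitz matrix with ones where `|k - l| = j`. -/
def symToeplitz (K j : ℕ) : Matrix (Fin (K + 1)) (Fin (K + 1)) ℝ :=
  Matrix.of fun k l => if |((k : ℕ) : ℤ) - ((l : ℕ) : ℤ)| = (j : ℤ) then 1 else 0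

/-- The skew-symmetric Toeplitz matrix with `1` where `l - k = j` and `-1` where `k - l = j`
(used for `j ≥ 1`). -/
def skewToeplitz (K j : ℕ) : Matrix (Fin (K + 1)) (Fin (K + 1)) ℝ :=
  Matrix.of fun k l =>
    if ((l : ℕ) : ℤ) - ((k : ℕ) : ℤ) = (j : ℤ) then 1
    else if ((k : ℕ) : ℤ) - ((l : ℕ) : ℤ) = (j : ℤ) then -1 else 0

/-- The block matrix `[C, 0; 0, C]` with `C = symToeplitz K j`. -/
def blockSym (K j : ℕ) :
    Matrix (Fin (K + 1) ⊕ Fin (K + 1)) (Fin (K + 1) ⊕ Fin (K + 1)) ℝ :=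
  Matrix.fromBlocks (symToeplitz K j) 0 0 (symToeplitz K j)

/-- The block matrix `[0, -C; C, 0]` with `C = skewToeplitz K j`. -/
def blockSkew (K j : ℕ) :
    Matrix (Fin (K + 1) ⊕ Fin (K + 1)) (Fin (K + 1) ⊕ Fin (K + 1)) ℝ :=
  Matrix.fromBlocks 0 (-skewToeplitz K j) (skewToeplitz K j) 0

/-- The feasible set of the semidefinite program `(TFP_K)`, the dual of the program
`max -(pᵀ w - qᵀ v)` subject to `E w - F v = -c` and
`∑_{k=0}^K w_k blockSym K k + ∑_{k=1}^K v_k blockSkew K k ⪰ 0`. -/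
def feasTFP {n : ℕ} (a : Fin (n + 1) → ℝ → ℝ) (K : ℕ) :
    Set (EuclideanSpace ℝ (Fin n) ×
      Matrix (Fin (K + 1) ⊕ Fin (K + 1)) (Fin (K + 1) ⊕ Fin (K + 1)) ℝ) :=
  {z | z.2.PosSemidef ∧
    (∀ k : ℕ, k ≤ K →
      (blockSym K k * z.2).trace + ∑ j : Fin n, cosEntry (a j.succ) k * z.1 j
        - cosEntry (a 0) k = 0) ∧
    (∀ k : ℕ, 1 ≤ k → k ≤ K →
      (blockSkew K k * z.2).trace - ∑ j : Fin n, sinEntry (a j.succ) k * z.1 j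
        + sinEntry (a 0) k = 0)}

/-- The set `S(TFP_K)` of optimal solutions of `min cᵀ x` over the feasible set of `(TFP_K)`. -/
def solTFP {n : ℕ} (a : Fin (n + 1) → ℝ → ℝ) (c : Fin n → ℝ) (K : ℕ) :
    Set (EuclideanSpace ℝ (Fin n) ×
      Matrix (Fin (K + 1) ⊕ Fin (K + 1)) (Fin (K + 1) ⊕ Fin (K + 1)) ℝ) :=
  {z | z ∈ feasTFP a K ∧ ∀ z' ∈ feasTFP a K, cost c z.1 ≤ cost c z'.1}

end TrigSIP

/-!
For a point `x` write `s = a_0 - ∑ a_j x_j` for the slack of the constraint. The program `(TFP_K)`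
is `(P)` with `s` replaced by the `K`-th partial sum of its Fourier series: this is
`exists_mem_feasTFP_iff`. One direction evaluates the quadratic form `Y` at two vectors of cosines
and sines (`sum_trace_eq`). The other needs a nonnegative trigonometric polynomial of degree `K` to
be a sum of squared moduli of polynomials of degree at most `K`, which is
`exists_sum_norm_sq_eq`, by induction on `K`: subtract the minimum, which makes a double root `z₀`
on the unit circle, and divide by `|z - z₀|²`.

The partial sums approximate a function as in the hypotheses up to `O(log K / K ^ (q + 1))`
(`HasLipschitzDeriv.exists_abs_sub_partialSum_le`). The `(q + 1)`-st derivative exists almost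
everywhere and is bounded, and a block `K < k ≤ M` of the Fourier series is its convolution with
`∑ k ^ (-(q + 1)) e^{iks}`, whose `L¹` norm is at most a constant times `log K / K ^ (q + 1)`:
Parseval's identity controls it on `|s| ≤ 1 / K` and summation by parts elsewhere.

It remains to perturb. Moving along the direction `xtilde` increases the slack uniformly, so a step
of size `O(log K / K ^ (q + 1))` turns a solution of `(P)` into a feasible point of `(TFP_K)`, and
an optimal point `x` of `(TFP_K)` into a feasible point of `(P)`. The second step is
proportional to `1 + ‖x‖`, which is bounded independently of `K` because the objective grows
linearly away from the bounded solution set (`exists_linear_growth`).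
-/

/-! ### The L¹ norm of the tail kernel -/

namespace TrigSIP

open MeasureTheory Finset

/-- The kernel `∑_{K < k ≤ M} k⁻ᵖ e^{iks}`: up to a constant factor, the block of frequencies
`K < k ≤ M` in the Fourier series of the `p`-fold antiderivative of a point mass. -/
noncomputable def tailKernel (p K M : ℕ) (s : ℝ) : ℂ :=
  ∑ k ∈ Ioc K M, (((k : ℝ) ^ p)⁻¹ : ℝ) * Complex.exp (Complex.I * k * s)

lemma continuous_tailKernel (p K M : ℕ) : Continuous (tailKernel p K M) := by
  unfold tailKernel
  fun_prop

lemma norm_tailKernel_neg (p K M : ℕ) (s : ℝ) :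
    ‖tailKernel p K M (-s)‖ = ‖tailKernel p K M s‖ := by
  rw [← Complex.norm_conj (tailKernel p K M s)]
  congr 1
  simp only [tailKernel, map_sum, map_mul, Complex.conj_ofReal, ← Complex.exp_conj,
    Complex.conj_I, Complex.conj_natCast, Complex.ofReal_neg]
  refine sum_congr rfl fun k _ => ?_
  ring_nf

lemma periodic_tailKernel (p K M : ℕ) :
    Function.Periodic (tailKernel p K M) (2 * Real.pi) := by
  intro s
  unfold tailKernel
  refine sum_congr rfl fun k _ => ?_
  congr 1
  rw [Complex.exp_eq_exp_iff_exists_int]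
  exact ⟨k, by push_cast; ring⟩

/-- Summation by parts for a power series with antitone nonnegative coefficients. -/
lemma norm_one_sub_mul_sum_le (b : ℕ → ℝ) (hb : ∀ k, 0 ≤ b k) (K : ℕ)
    (hanti : ∀ k, K < k → b (k + 1) ≤ b k) (z : ℂ) (hz : ‖z‖ = 1) (M : ℕ) (hM : K < M) :
    ‖(1 - z) * ∑ k ∈ Ioc K M, (b k : ℂ) * z ^ k‖ ≤ 2 * b (K + 1) := by
  have key : ‖(1 - z) * ∑ k ∈ Ioc K M, (b k : ℂ) * z ^ k + b M * z ^ (M + 1)‖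
      ≤ 2 * b (K + 1) - b M := by
    induction M, hM using Nat.le_induction with
    | base =>
      rw [Nat.succ_eq_add_one, Nat.Ioc_succ_singleton, sum_singleton]
      have : (1 - z) * ((b (K + 1) : ℂ) * z ^ (K + 1)) + b (K + 1) * z ^ (K + 1 + 1)
          = b (K + 1) * z ^ (K + 1) := by ring
      rw [this, norm_mul, norm_pow, hz, Complex.norm_real, Real.norm_of_nonneg (hb _)]
      simp; linarith
    | succ M hM ih =>
      rw [sum_Ioc_succ_top (by omega)]
      have : (1 - z) * (∑ k ∈ Ioc K M, (b k : ℂ) * z ^ k + b (M + 1) * z ^ (M + 1))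
            + b (M + 1) * z ^ (M + 1 + 1)
          = ((1 - z) * ∑ k ∈ Ioc K M, (b k : ℂ) * z ^ k + b M * z ^ (M + 1))
            - ((b M - b (M + 1) : ℝ) : ℂ) * z ^ (M + 1) := by push_cast; ring
      rw [this]
      refine (norm_sub_le _ _).trans ?_
      rw [norm_mul _ (z ^ (M + 1)), norm_pow, hz, Complex.norm_real,
        Real.norm_of_nonneg (sub_nonneg.2 (hanti M (by omega)))]
      simp only [one_pow, mul_one]
      linarith
  have h1 : ‖(b M : ℂ) * z ^ (M + 1)‖ = b M := by
    rw [norm_mul, norm_pow, hz, Complex.norm_real, Real.norm_of_nonneg (hb _)]; simp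
  have := norm_sub_le ((1 - z) * ∑ k ∈ Ioc K M, (b k : ℂ) * z ^ k + b M * z ^ (M + 1))
    (b M * z ^ (M + 1))
  rw [add_sub_cancel_right] at this
  linarith

lemma two_div_pi_mul_le_norm_one_sub_exp {s : ℝ} (h0 : 0 ≤ s) (hπ : s ≤ Real.pi) :
    2 / Real.pi * s ≤ ‖1 - Complex.exp (Complex.I * s)‖ := by
  rw [norm_sub_rev, Complex.norm_exp_I_mul_ofReal_sub_one, Real.norm_eq_abs]
  have := Real.mul_le_sin (x := s / 2) (by linarith) (by linarith)
  refine le_trans ?_ (le_abs_self _)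
  linarith

/-- Away from the origin the kernel decays like `1 / s`. -/
lemma norm_tailKernel_le_div (p K M : ℕ) (hK : 1 ≤ K) {s : ℝ} (h0 : 0 < s) (hπ : s ≤ Real.pi) :
    ‖tailKernel p K M s‖ ≤ Real.pi * ((K : ℝ) ^ p)⁻¹ * s⁻¹ := by
  have hK' : (0 : ℝ) < K := by exact_mod_cast hK
  rcases le_or_gt M K with hM | hM
  · simp only [tailKernel, Ioc_eq_empty_of_le hM, sum_empty, norm_zero]
    positivity
  have hA := norm_one_sub_mul_sum_le (fun k => ((k : ℝ) ^ p)⁻¹) (fun k => by positivity) K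
    (fun k hk => by
      have : (0 : ℝ) < k := by exact_mod_cast (by omega : 0 < k)
      push_cast
      gcongr
      linarith) (Complex.exp (Complex.I * s)) (Complex.norm_exp_I_mul_ofReal s) M hM
  have hsum : ∑ k ∈ Ioc K M, ((((k : ℝ) ^ p)⁻¹ : ℝ) : ℂ) * Complex.exp (Complex.I * s) ^ k
      = tailKernel p K M s := by
    refine sum_congr rfl fun k _ => ?_
    rw [← Complex.exp_nat_mul]
    congr 2
    ring
  rw [hsum, norm_mul] at hA
  have hB := two_div_pi_mul_le_norm_one_sub_exp h0.le hπ
  have hC : (((K + 1 : ℕ) : ℝ) ^ p)⁻¹ ≤ ((K : ℝ) ^ p)⁻¹ := by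
    gcongr
    linarith
  have hD : 2 / Real.pi * s * ‖tailKernel p K M s‖ ≤ 2 * ((K : ℝ) ^ p)⁻¹ :=
    (mul_le_mul_of_nonneg_right hB (norm_nonneg _)).trans (hA.trans (by linarith))
  have hpi := Real.pi_pos
  have : ‖tailKernel p K M s‖
      = (2 / Real.pi * s * ‖tailKernel p K M s‖) * (Real.pi / 2 * s⁻¹) := by field_simp
  rw [this]
  calc _ ≤ 2 * ((K : ℝ) ^ p)⁻¹ * (Real.pi / 2 * s⁻¹) := by gcongr
    _ = _ := by ring

lemma integral_exp_int_mul (n : ℤ) :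
    ∫ s in (0 : ℝ)..(2 * Real.pi), Complex.exp (Complex.I * n * s)
      = if n = 0 then 2 * (Real.pi : ℂ) else 0 := by
  split_ifs with h
  · simp [h]
  · have hc : (Complex.I * n : ℂ) ≠ 0 := mul_ne_zero Complex.I_ne_zero (by exact_mod_cast h)
    rw [integral_exp_mul_complex hc]
    have : Complex.exp (Complex.I * n * ((2 * Real.pi : ℝ) : ℂ)) = 1 := by
      rw [Complex.exp_eq_one_iff]; exact ⟨n, by push_cast; ring⟩
    rw [this]; simp

lemma integral_norm_sq_tailKernel (p K M : ℕ) :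
    ∫ s in (0 : ℝ)..(2 * Real.pi), ‖tailKernel p K M s‖ ^ 2
      = 2 * Real.pi * ∑ k ∈ Ioc K M, (((k : ℝ) ^ p)⁻¹) ^ 2 := by
  have h1 : ∀ s : ℝ, ((‖tailKernel p K M s‖ ^ 2 : ℝ) : ℂ)
      = ∑ j ∈ Ioc K M, ∑ k ∈ Ioc K M, (((((j : ℝ) ^ p)⁻¹ * ((k : ℝ) ^ p)⁻¹ : ℝ)) : ℂ) *
          Complex.exp (Complex.I * ((j - k : ℤ) : ℂ) * s) := by
    intro s
    push_cast
    rw [← Complex.mul_conj']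
    simp only [tailKernel, map_sum, map_mul, Complex.conj_ofReal, ← Complex.exp_conj,
      Complex.conj_I, Complex.conj_natCast, sum_mul_sum]
    refine sum_congr rfl fun j _ => sum_congr rfl fun k _ => ?_
    rw [mul_mul_mul_comm, ← Complex.exp_add]
    push_cast
    congr 2
    ring
  have h2 : ((∫ s in (0 : ℝ)..(2 * Real.pi), ‖tailKernel p K M s‖ ^ 2 : ℝ) : ℂ)
      = ((2 * Real.pi * ∑ k ∈ Ioc K M, (((k : ℝ) ^ p)⁻¹) ^ 2 : ℝ) : ℂ) := by
    rw [← intervalIntegral.integral_ofReal]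
    simp_rw [h1]
    rw [intervalIntegral.integral_finsetSum
      (fun j _ => Continuous.intervalIntegrable (by fun_prop) _ _)]
    push_cast
    rw [mul_sum]
    refine sum_congr rfl fun j hj => ?_
    rw [intervalIntegral.integral_finsetSum
      (fun k _ => Continuous.intervalIntegrable (by fun_prop) _ _)]
    rw [sum_eq_single j]
    · rw [intervalIntegral.integral_const_mul]
      have := integral_exp_int_mul ((j : ℤ) - j)
      rw [if_pos (sub_self _)] at this
      push_cast at this
      rw [this]
      ring
    · intro k _ hk
      rw [intervalIntegral.integral_const_mul]
      have := integral_exp_int_mul ((j : ℤ) - k)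
      rw [if_neg (by omega)] at this
      push_cast at this
      rw [this, mul_zero]
    · exact fun h => absurd hj h
  exact_mod_cast h2

lemma sum_inv_pow_sq_le (p K M : ℕ) (hK : 1 ≤ K) (hp : 1 ≤ p) :
    ∑ k ∈ Ioc K M, (((k : ℝ) ^ p)⁻¹) ^ 2 ≤ ((K : ℝ) ^ (2 * p - 1))⁻¹ := by
  have hK' : (0 : ℝ) < K := by exact_mod_cast hK
  rcases le_or_gt M K with hM | hM
  · rw [Ioc_eq_empty_of_le hM, sum_empty]; positivity
  obtain ⟨r, rfl⟩ : ∃ r, p = r + 1 := ⟨p - 1, by omega⟩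
  calc ∑ k ∈ Ioc K M, (((k : ℝ) ^ (r + 1))⁻¹) ^ 2
      ≤ ∑ k ∈ Ioc K M, ((K : ℝ) ^ (2 * r))⁻¹ * ((k : ℝ) ^ 2)⁻¹ := by
        refine sum_le_sum fun k hk => ?_
        have hk' : (K : ℝ) ≤ k := by exact_mod_cast (mem_Ioc.1 hk).1.le
        have : (((k : ℝ) ^ (r + 1))⁻¹) ^ 2 = ((k : ℝ) ^ (2 * r))⁻¹ * ((k : ℝ) ^ 2)⁻¹ := by
          rw [← mul_inv, inv_pow]; ring_nf
        rw [this]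
        gcongr
    _ ≤ ((K : ℝ) ^ (2 * r))⁻¹ * (K : ℝ)⁻¹ := by
        rw [← mul_sum]
        gcongr
        refine (sum_Ioc_inv_sq_le_sub (by omega) hM.le).trans ?_
        have : (0 : ℝ) ≤ (M : ℝ)⁻¹ := by positivity
        linarith
    _ = _ := by
        rw [← mul_inv, ← pow_succ]; rfl

/-- The `L¹` norm of the kernel is `O(log K / K^p)`, uniformly in `M`. On `[0, 1/K]` the `L²` norm
controls it, on `[1/K, π]` the decay `1 / s` does. -/
lemma integral_norm_tailKernel_half_le (p K M : ℕ) (hK : 1 ≤ K) (hp : 1 ≤ p) :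
    ∫ s in (0 : ℝ)..Real.pi, ‖tailKernel p K M s‖
      ≤ (1 / 2 + Real.pi + Real.pi * (Real.log Real.pi + Real.log K)) * ((K : ℝ) ^ p)⁻¹ := by
  have hK' : (0 : ℝ) < K := by exact_mod_cast hK
  have hpi := Real.pi_gt_three
  have hK1 : (1 : ℝ) ≤ K := by exact_mod_cast hK
  have hinv : (K : ℝ)⁻¹ ≤ 1 := inv_le_one_of_one_le₀ hK1
  have hinv0 : (0 : ℝ) < (K : ℝ)⁻¹ := by positivity
  have hc := (continuous_tailKernel p K M).norm
  have hc2 : Continuous fun s => ‖tailKernel p K M s‖ ^ 2 := hc.pow 2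
  obtain ⟨r, rfl⟩ : ∃ r, p = r + 1 := ⟨p - 1, by omega⟩
  rw [← intervalIntegral.integral_add_adjacent_intervals (b := (K : ℝ)⁻¹)
    (hc.intervalIntegrable _ _) (hc.intervalIntegrable _ _)]
  have near : ∫ s in (0 : ℝ)..(K : ℝ)⁻¹, ‖tailKernel (r + 1) K M s‖
      ≤ (1 / 2 + Real.pi) * ((K : ℝ) ^ (r + 1))⁻¹ := by
    have hsq : ∫ s in (0 : ℝ)..(K : ℝ)⁻¹, ‖tailKernel (r + 1) K M s‖ ^ 2
        ≤ 2 * Real.pi * ((K : ℝ) ^ (2 * r + 1))⁻¹ := by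
      calc _ ≤ ∫ s in (0 : ℝ)..(2 * Real.pi), ‖tailKernel (r + 1) K M s‖ ^ 2 := by
            refine intervalIntegral.integral_mono_interval le_rfl hinv0.le (by linarith)
              (Filter.Eventually.of_forall fun s => by positivity) (hc2.intervalIntegrable _ _)
        _ ≤ _ := by
            rw [integral_norm_sq_tailKernel]
            have := sum_inv_pow_sq_le (r + 1) K M hK hp
            rw [show 2 * (r + 1) - 1 = 2 * r + 1 by omega] at this
            gcongr
    -- The weight `K ^ r` balances the two terms of the AM-GM inequality.
    calc ∫ s in (0 : ℝ)..(K : ℝ)⁻¹, ‖tailKernel (r + 1) K M s‖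
        ≤ ∫ s in (0 : ℝ)..(K : ℝ)⁻¹,
            (((K : ℝ) ^ r)⁻¹ / 2 + (K : ℝ) ^ r / 2 * ‖tailKernel (r + 1) K M s‖ ^ 2) := by
          refine intervalIntegral.integral_mono_on hinv0.le (hc.intervalIntegrable _ _)
            ((continuous_const.add (continuous_const.mul hc2)).intervalIntegrable _ _) ?_
          intro s _
          set x := ‖tailKernel (r + 1) K M s‖
          have hl : (0 : ℝ) < (K : ℝ) ^ r := by positivity
          set l := (K : ℝ) ^ r
          have h0 : 0 ≤ l⁻¹ / 2 * (1 - l * x) ^ 2 := by positivity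
          have h1 : l⁻¹ / 2 * (1 - l * x) ^ 2 = l⁻¹ / 2 + l / 2 * x ^ 2 - x := by
            field_simp; ring
          linarith
      _ = (K : ℝ)⁻¹ * (((K : ℝ) ^ r)⁻¹ / 2)
            + (K : ℝ) ^ r / 2 * ∫ s in (0 : ℝ)..(K : ℝ)⁻¹, ‖tailKernel (r + 1) K M s‖ ^ 2 := by
          rw [intervalIntegral.integral_add (by simp) ((hc2.intervalIntegrable _ _).const_mul _),
            intervalIntegral.integral_const_mul]
          simp [mul_div_assoc]
      _ ≤ (K : ℝ)⁻¹ * (((K : ℝ) ^ r)⁻¹ / 2)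
            + (K : ℝ) ^ r / 2 * (2 * Real.pi * ((K : ℝ) ^ (2 * r + 1))⁻¹) := by gcongr
      _ = _ := by field_simp; ring
  have far : ∫ s in (K : ℝ)⁻¹..Real.pi, ‖tailKernel (r + 1) K M s‖
      ≤ Real.pi * (Real.log Real.pi + Real.log K) * ((K : ℝ) ^ (r + 1))⁻¹ := by
    have hint : IntervalIntegrable (fun s : ℝ => s⁻¹) volume (K : ℝ)⁻¹ Real.pi := by
      refine intervalIntegral.intervalIntegrable_inv (fun s hs => ?_) continuousOn_id
      rw [Set.uIcc_of_le (by linarith)] at hs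
      exact (hinv0.trans_le hs.1).ne'
    calc _ ≤ ∫ s in (K : ℝ)⁻¹..Real.pi, Real.pi * ((K : ℝ) ^ (r + 1))⁻¹ * s⁻¹ := by
          refine intervalIntegral.integral_mono_on (by linarith) (hc.intervalIntegrable _ _)
            (hint.const_mul _) ?_
          intro s hs
          exact norm_tailKernel_le_div _ _ _ hK (hinv0.trans_le hs.1) hs.2
      _ = _ := by
          rw [intervalIntegral.integral_const_mul, integral_inv_of_pos hinv0 (by linarith),
            div_inv_eq_mul, Real.log_mul (by linarith) hK'.ne']
          ring
  calc _ ≤ (1 / 2 + Real.pi) * ((K : ℝ) ^ (r + 1))⁻¹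
        + Real.pi * (Real.log Real.pi + Real.log K) * ((K : ℝ) ^ (r + 1))⁻¹ := add_le_add near far
    _ = _ := by ring

lemma exists_integral_norm_tailKernel_le :
    ∃ A : ℝ, 0 < A ∧ ∀ p K M : ℕ, 2 ≤ K → 1 ≤ p → ∀ t : ℝ,
      ∫ s in (0 : ℝ)..(2 * Real.pi), ‖tailKernel p K M (s - t)‖
        ≤ A * (Real.log K / (K : ℝ) ^ p) := by
  have hpi := Real.pi_gt_three
  have hlp : 0 < Real.log Real.pi := Real.log_pos (by linarith)
  have hl2 : 0 < Real.log 2 := Real.log_pos (by norm_num)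
  set B := 1 / 2 + Real.pi + Real.pi * Real.log Real.pi with hB
  have hB0 : 0 < B := by positivity
  refine ⟨2 * (B / Real.log 2 + Real.pi), by positivity, fun p K M hK hp t => ?_⟩
  have hlK : Real.log 2 ≤ Real.log K := Real.log_le_log (by norm_num) (by exact_mod_cast hK)
  have hc := (continuous_tailKernel p K M).norm
  have hper : Function.Periodic (fun s => ‖tailKernel p K M s‖) (2 * Real.pi) :=
    fun s => by simp only [periodic_tailKernel p K M s]
  have e1 : ∫ s in (0 : ℝ)..(2 * Real.pi), ‖tailKernel p K M (s - t)‖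
      = ∫ s in (-Real.pi)..Real.pi, ‖tailKernel p K M s‖ := by
    rw [intervalIntegral.integral_comp_sub_right (fun s => ‖tailKernel p K M s‖)]
    have := hper.intervalIntegral_add_eq (0 - t) (-Real.pi)
    convert this using 2 <;> ring
  have e2 : ∫ s in (-Real.pi)..0, ‖tailKernel p K M s‖
      = ∫ s in (0 : ℝ)..Real.pi, ‖tailKernel p K M s‖ := by
    rw [← neg_zero, ← intervalIntegral.integral_comp_neg]
    simp [norm_tailKernel_neg]
  rw [e1, ← intervalIntegral.integral_add_adjacent_intervals (b := 0)
    (hc.intervalIntegrable _ _) (hc.intervalIntegrable _ _), e2, ← two_mul]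
  have h := integral_norm_tailKernel_half_le p K M (by omega) hp
  have hB1 : B ≤ B / Real.log 2 * Real.log K := by
    rw [div_mul_eq_mul_div, le_div_iff₀ hl2]
    gcongr
  have hKp : (0 : ℝ) ≤ ((K : ℝ) ^ p)⁻¹ := by positivity
  calc _ ≤ 2 * ((B + Real.pi * Real.log K) * ((K : ℝ) ^ p)⁻¹) := by
        rw [hB]
        refine mul_le_mul_of_nonneg_left (h.trans (le_of_eq ?_)) (by norm_num)
        ring
    _ ≤ 2 * ((B / Real.log 2 * Real.log K + Real.pi * Real.log K) * ((K : ℝ) ^ p)⁻¹) := by gcongr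
    _ = _ := by rw [div_eq_mul_inv (Real.log K)]; ring

end TrigSIP

/-! ### Fourier coefficients and derivatives -/

namespace TrigSIP

open MeasureTheory

lemma coef_congr {f g : ℝ → ℝ} (h : Set.EqOn f g (Set.Ioo 0 (2 * Real.pi))) (k : ℤ) :
    coef f k = coef g k := by
  unfold coef
  congr 1
  rw [intervalIntegral.integral_of_le Real.two_pi_pos.le,
    intervalIntegral.integral_of_le Real.two_pi_pos.le, integral_Ioc_eq_integral_Ioo,
    integral_Ioc_eq_integral_Ioo]
  refine setIntegral_congr_fun measurableSet_Ioo fun t ht => ?_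
  simp only [h ht]

lemma intervalIntegrable_ofReal {f : ℝ → ℝ} {a b : ℝ} (hf : IntervalIntegrable f volume a b) :
    IntervalIntegrable (fun t => (f t : ℂ)) volume a b :=
  ⟨hf.1.integrable.ofReal, hf.2.integrable.ofReal⟩

lemma coef_eq {f : ℝ → ℝ} (hf : IntervalIntegrable f volume 0 (2 * Real.pi)) (k : ℤ) :
    coef f k = 1 / (2 * (Real.pi : ℂ)) *
      (((∫ t in (0 : ℝ)..(2 * Real.pi), f t * Real.cos (k * t) : ℝ) : ℂ) +
        Complex.I * ((∫ t in (0 : ℝ)..(2 * Real.pi), f t * Real.sin (k * t) : ℝ) : ℂ)) := by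
  unfold coef
  congr 1
  have hc : IntervalIntegrable (fun t => f t * Real.cos (k * t)) volume 0 (2 * Real.pi) :=
    hf.mul_continuousOn (by fun_prop)
  have hs : IntervalIntegrable (fun t => f t * Real.sin (k * t)) volume 0 (2 * Real.pi) :=
    hf.mul_continuousOn (by fun_prop)
  rw [← intervalIntegral.integral_ofReal, ← intervalIntegral.integral_ofReal,
    ← intervalIntegral.integral_const_mul, ← intervalIntegral.integral_add
      (intervalIntegrable_ofReal hc) ((intervalIntegrable_ofReal hs).const_mul _)]
  refine intervalIntegral.integral_congr fun t _ => ?_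
  have : Complex.I * k * t = ((k * t : ℝ) : ℂ) * Complex.I := by push_cast; ring
  simp only [this, Complex.exp_mul_I]
  push_cast
  ring

lemma coef_neg (f : ℝ → ℝ) (k : ℤ) : coef f (-k) = (starRingEnd ℂ) (coef f k) := by
  unfold coef
  rw [map_mul, intervalIntegral.integral_of_le Real.two_pi_pos.le,
    intervalIntegral.integral_of_le Real.two_pi_pos.le, ← integral_conj]
  congr 1
  · simp [Complex.conj_ofNat]
  · congr 1
    ext t
    simp [← Complex.exp_conj]

/-- Integration by parts: the boundary terms cancel because `f` takes the same values at the
two end points. -/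
lemma coef_deriv {f : ℝ → ℝ} (hf : AbsolutelyContinuousOnInterval f 0 (2 * Real.pi))
    (h0 : f 0 = f (2 * Real.pi)) (k : ℤ) :
    coef (deriv f) k = -(Complex.I * k) * coef f k := by
  rw [coef_eq hf.intervalIntegrable_deriv, coef_eq hf.continuousOn.intervalIntegrable]
  have hcos : AbsolutelyContinuousOnInterval (fun t => Real.cos (k * t)) 0 (2 * Real.pi) :=
    ContDiffOn.absolutelyContinuousOnInterval (ContDiff.contDiffOn (by fun_prop))
  have hsin : AbsolutelyContinuousOnInterval (fun t => Real.sin (k * t)) 0 (2 * Real.pi) :=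
    ContDiffOn.absolutelyContinuousOnInterval (ContDiff.contDiffOn (by fun_prop))
  have dcos : deriv (fun t : ℝ => Real.cos (k * t)) = fun t => -(k * Real.sin (k * t)) := by
    ext t
    have := ((hasDerivAt_id t).const_mul (k : ℝ)).cos.deriv
    simp only [id, mul_one] at this
    rw [this]; ring
  have dsin : deriv (fun t : ℝ => Real.sin (k * t)) = fun t => k * Real.cos (k * t) := by
    ext t
    have := ((hasDerivAt_id t).const_mul (k : ℝ)).sin.deriv
    simp only [id, mul_one] at this
    rw [this]; ring
  have vcos : Real.cos (k * (2 * Real.pi)) = 1 := Real.cos_int_mul_two_pi k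
  have vsin : Real.sin (k * (2 * Real.pi)) = 0 := by
    have := Real.sin_int_mul_pi (2 * k)
    rw [← this]; push_cast; ring_nf
  have e1 : ∫ t in (0 : ℝ)..(2 * Real.pi), deriv f t * Real.cos (k * t)
      = k * ∫ t in (0 : ℝ)..(2 * Real.pi), f t * Real.sin (k * t) := by
    have := hcos.integral_mul_deriv_eq_deriv_mul hf
    rw [dcos] at this
    simp only [vcos, mul_zero, Real.cos_zero, h0, sub_self, zero_sub] at this
    rw [← intervalIntegral.integral_const_mul, ← intervalIntegral.integral_congr
      (fun t _ => mul_comm (Real.cos (k * t)) (deriv f t)), this,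
      ← intervalIntegral.integral_neg]
    exact intervalIntegral.integral_congr fun t _ => by ring
  have e2 : ∫ t in (0 : ℝ)..(2 * Real.pi), deriv f t * Real.sin (k * t)
      = -(k * ∫ t in (0 : ℝ)..(2 * Real.pi), f t * Real.cos (k * t)) := by
    have := hsin.integral_mul_deriv_eq_deriv_mul hf
    rw [dsin] at this
    simp only [vsin, mul_zero, Real.sin_zero, zero_mul, sub_self, zero_sub] at this
    rw [← intervalIntegral.integral_const_mul, ← intervalIntegral.integral_congr
      (fun t _ => mul_comm (Real.sin (k * t)) (deriv f t)), this]
    congr 1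
    exact intervalIntegral.integral_congr fun t _ => by ring
  rw [e1, e2]
  push_cast
  linear_combination (1 / (2 * (Real.pi : ℂ)) * k *
    (∫ t in (0 : ℝ)..(2 * Real.pi), f t * Real.sin (k * t) : ℝ)) * Complex.I_sq

lemma uniqueDiffOn_period : UniqueDiffOn ℝ period := uniqueDiffOn_Icc Real.two_pi_pos

lemma iteratedDerivWithin_succ_eqOn_deriv (l : ℕ) (f : ℝ → ℝ) :
    Set.EqOn (iteratedDerivWithin (l + 1) f period) (deriv (iteratedDerivWithin l f period))
      (Set.Ioo 0 (2 * Real.pi)) := by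
  intro t ht
  rw [iteratedDerivWithin_succ]
  exact derivWithin_of_mem_nhds (Icc_mem_nhds ht.1 ht.2)

lemma HasLipschitzDeriv.continuousOn {q : ℕ} {f : ℝ → ℝ} (hf : HasLipschitzDeriv q f) {l : ℕ}
    (hl : l ≤ q) : ContinuousOn (iteratedDerivWithin l f period) period := by
  rcases hl.lt_or_eq with h | rfl
  · exact (hf.1 l h).continuousOn
  · exact hf.2.choose_spec.continuousOn

lemma HasLipschitzDeriv.absolutelyContinuous {q : ℕ} {f : ℝ → ℝ} (hf : HasLipschitzDeriv q f)
    {l : ℕ} (hl : l ≤ q) :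
    AbsolutelyContinuousOnInterval (iteratedDerivWithin l f period) 0 (2 * Real.pi) := by
  have hI : Set.uIcc 0 (2 * Real.pi) = period := Set.uIcc_of_le Real.two_pi_pos.le
  rcases hl.lt_or_eq with h | rfl
  · refine ContDiffOn.absolutelyContinuousOnInterval ?_
    rw [hI, show (1 : WithTop ℕ∞) = 0 + 1 by simp, contDiffOn_succ_iff_derivWithin
      uniqueDiffOn_period]
    refine ⟨hf.1 l h, by simp, contDiffOn_zero.2 ?_⟩
    have := hf.continuousOn (l := l + 1) h
    refine this.congr fun t _ => ?_
    rw [iteratedDerivWithin_succ]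
  · obtain ⟨C, hC⟩ := hf.2
    refine LipschitzOnWith.absolutelyContinuousOnInterval (K := C) ?_
    rwa [hI]

/-- The `(q + 1)`-st derivative of `f`, which exists almost everywhere: a bounded measurable
function whose Fourier coefficients are the expected multiples of those of `f`. -/
lemma HasLipschitzDeriv.exists_bounded_deriv {q : ℕ} {f : ℝ → ℝ} (hf : HasLipschitzDeriv q f)
    (hp : PeriodicDerivs q f) :
    ∃ h : ℝ → ℝ, Measurable h ∧ (∃ C : ℝ, 0 ≤ C ∧ ∀ t, |h t| ≤ C) ∧
      ∀ k : ℤ, coef h k = (-(Complex.I * k)) ^ (q + 1) * coef f k := by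
  have hl : ∀ l ≤ q, ∀ k : ℤ, coef (iteratedDerivWithin l f period) k
      = (-(Complex.I * k)) ^ l * coef f k := by
    intro l hl k
    induction l with
    | zero => simp
    | succ l ih =>
      rw [coef_congr (iteratedDerivWithin_succ_eqOn_deriv l f) k,
        coef_deriv (hf.absolutelyContinuous (by omega)) (hp l (by omega)), ih (by omega)]
      ring
  obtain ⟨C, hC⟩ := hf.2
  refine ⟨(Set.Ioo 0 (2 * Real.pi)).indicator (deriv (iteratedDerivWithin q f period)),
    (measurable_deriv _).indicator measurableSet_Ioo, ⟨C, C.2, fun t => ?_⟩, fun k => ?_⟩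
  · by_cases ht : t ∈ Set.Ioo 0 (2 * Real.pi)
    · rw [Set.indicator_of_mem ht, ← Real.norm_eq_abs]
      exact norm_deriv_le_of_lipschitzOn (Icc_mem_nhds ht.1 ht.2) hC
    · rw [Set.indicator_of_notMem ht, abs_zero]; exact C.2
  · rw [coef_congr (g := deriv (iteratedDerivWithin q f period))
      (fun t ht => Set.indicator_of_mem ht _) k,
      coef_deriv (hf.absolutelyContinuous le_rfl) (hp q le_rfl), hl q le_rfl]
    ring

end TrigSIP

/-! ### Approximation by Fourier partial sums -/

namespace TrigSIP

open MeasureTheory Finset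

/-- The `K`-th partial sum of the real Fourier series of `f`. -/
noncomputable def partialSum (f : ℝ → ℝ) (K : ℕ) (t : ℝ) : ℝ :=
  ∑ k ∈ range (K + 1), (cosEntry f k * Real.cos (k * t) + sinEntry f k * Real.sin (k * t))

lemma partialSum_term (f : ℝ → ℝ) {k : ℕ} (hk : k ≠ 0) (t : ℝ) :
    cosEntry f k * Real.cos (k * t) + sinEntry f k * Real.sin (k * t)
      = 2 * (coef f k * Complex.exp (-(Complex.I * k * t))).re := by
  have h : -(Complex.I * k * t) = ((-(k * t) : ℝ) : ℂ) * Complex.I := by push_cast; ring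
  rw [cosEntry, sinEntry, if_neg hk, coef_neg, Complex.conj_re, Complex.conj_im, h, Complex.mul_re,
    Complex.exp_ofReal_mul_I_re, Complex.exp_ofReal_mul_I_im, Real.cos_neg, Real.sin_neg]
  ring

lemma partialSum_sub (f : ℝ → ℝ) {K M : ℕ} (hKM : K ≤ M) (t : ℝ) :
    partialSum f M t - partialSum f K t
      = 2 * (∑ k ∈ Ioc K M, coef f k * Complex.exp (-(Complex.I * k * t))).re := by
  induction M, hKM using Nat.le_induction with
  | base => simp
  | succ M hM ih =>
    rw [sum_Ioc_succ_top (by omega), Complex.add_re, mul_add, ← ih,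
      ← partialSum_term f (Nat.succ_ne_zero M) t]
    simp only [partialSum, sum_range_succ _ (M + 1)]
    ring

lemma coef_norm_eq {f h : ℝ → ℝ} {p : ℕ}
    (hcoef : ∀ k : ℤ, coef h k = (-(Complex.I * k)) ^ p * coef f k) (k : ℤ) :
    ‖coef h k‖ = |(k : ℝ)| ^ p * ‖coef f k‖ := by
  rw [hcoef, norm_mul, norm_pow, norm_neg, norm_mul, Complex.norm_I, one_mul]
  simp

/-- Up to a constant factor, a block of positive frequencies in the Fourier series of `f` is the
convolution of `tailKernel` with `h`, which plays the part of the `p`-th derivative of `f`. -/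
lemma sum_coef_mul_exp_eq {f h : ℝ → ℝ} {p : ℕ} (hh : IntervalIntegrable h volume 0 (2 * Real.pi))
    (hcoef : ∀ k : ℤ, coef h k = (-(Complex.I * k)) ^ p * coef f k) (K M : ℕ) (t : ℝ) :
    (-Complex.I) ^ p * ∑ k ∈ Ioc K M, coef f k * Complex.exp (-(Complex.I * k * t))
      = 1 / (2 * (Real.pi : ℂ)) *
        ∫ s in (0 : ℝ)..(2 * Real.pi), (h s : ℂ) * tailKernel p K M (s - t) := by
  have hh' := intervalIntegrable_ofReal hh
  simp only [tailKernel, mul_sum]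
  rw [intervalIntegral.integral_finsetSum
    (fun k _ => hh'.mul_continuousOn (Continuous.continuousOn (by fun_prop))), mul_sum]
  refine sum_congr rfl fun k hk => ?_
  have hk0 : (k : ℂ) ≠ 0 := by
    have := (mem_Ioc.1 hk).1
    exact_mod_cast (by omega : k ≠ 0)
  have e : ∀ s : ℝ, (h s : ℂ) * (((((k : ℝ) ^ p)⁻¹ : ℝ) : ℂ) *
      Complex.exp (Complex.I * k * ((s - t : ℝ) : ℂ)))
      = (((k : ℂ) ^ p)⁻¹ * Complex.exp (-(Complex.I * k * t))) *
        ((h s : ℂ) * Complex.exp (Complex.I * ((k : ℤ) : ℂ) * s)) := by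
    intro s
    have : Complex.I * k * ((s - t : ℝ) : ℂ)
        = -(Complex.I * k * t) + Complex.I * ((k : ℤ) : ℂ) * s := by push_cast; ring
    rw [this, Complex.exp_add]
    push_cast
    ring
  simp_rw [e]
  rw [intervalIntegral.integral_const_mul]
  have hc := hcoef k
  rw [coef] at hc
  have : 1 / (2 * (Real.pi : ℂ)) * ((((k : ℂ) ^ p)⁻¹ * Complex.exp (-(Complex.I * k * t))) *
        ∫ s in (0 : ℝ)..(2 * Real.pi), (h s : ℂ) * Complex.exp (Complex.I * ((k : ℤ) : ℂ) * s))
      = ((k : ℂ) ^ p)⁻¹ * Complex.exp (-(Complex.I * k * t)) * (1 / (2 * (Real.pi : ℂ)) *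
        ∫ s in (0 : ℝ)..(2 * Real.pi), (h s : ℂ) * Complex.exp (Complex.I * ((k : ℤ) : ℂ) * s)) := by
    ring
  rw [this, hc, ← neg_mul Complex.I ((k : ℤ) : ℂ), mul_pow]
  push_cast
  field_simp

lemma intervalIntegrable_of_bounded {h : ℝ → ℝ} (hm : Measurable h) {C : ℝ}
    (hC : ∀ t, |h t| ≤ C) (a b : ℝ) : IntervalIntegrable h volume a b :=
  (intervalIntegrable_const (c := C)).mono_fun hm.aestronglyMeasurable
    (Filter.Eventually.of_forall fun t => by
      rw [Real.norm_eq_abs]; exact (hC t).trans (le_abs_self C))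

lemma abs_partialSum_sub_le {f h : ℝ → ℝ} {p : ℕ} (hm : Measurable h) {C : ℝ}
    (hC : ∀ t, |h t| ≤ C) (hcoef : ∀ k : ℤ, coef h k = (-(Complex.I * k)) ^ p * coef f k)
    {K M : ℕ} (hKM : K ≤ M) (t : ℝ) :
    |partialSum f M t - partialSum f K t|
      ≤ C * ∫ s in (0 : ℝ)..(2 * Real.pi), ‖tailKernel p K M (s - t)‖ := by
  have hpi := Real.pi_gt_three
  have hC0 : 0 ≤ C := (abs_nonneg _).trans (hC 0)
  have hc : Continuous fun s => ‖tailKernel p K M (s - t)‖ :=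
    ((continuous_tailKernel p K M).comp (continuous_id.sub continuous_const)).norm
  have hI : 0 ≤ ∫ s in (0 : ℝ)..(2 * Real.pi), ‖tailKernel p K M (s - t)‖ :=
    intervalIntegral.integral_nonneg Real.two_pi_pos.le fun s _ => norm_nonneg _
  have hblock := congrArg norm
    (sum_coef_mul_exp_eq (intervalIntegrable_of_bounded hm hC _ _) hcoef K M t)
  rw [norm_mul, norm_pow, norm_neg, Complex.norm_I, one_pow, one_mul, norm_mul] at hblock
  have hint : ‖∫ s in (0 : ℝ)..(2 * Real.pi), (h s : ℂ) * tailKernel p K M (s - t)‖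
      ≤ C * ∫ s in (0 : ℝ)..(2 * Real.pi), ‖tailKernel p K M (s - t)‖ := by
    rw [← intervalIntegral.integral_const_mul]
    refine intervalIntegral.norm_integral_le_of_norm_le Real.two_pi_pos.le
      (Filter.Eventually.of_forall fun s _ => ?_) ((continuous_const.mul hc).intervalIntegrable _ _)
    rw [norm_mul, Complex.norm_real, Real.norm_eq_abs]
    exact mul_le_mul_of_nonneg_right (hC s) (norm_nonneg _)
  have hfac : ‖1 / (2 * (Real.pi : ℂ))‖ ≤ 1 / 2 := by
    rw [norm_div, norm_mul, Complex.norm_real, Real.norm_of_nonneg (by linarith), norm_one,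
      Complex.norm_ofNat]
    exact one_div_le_one_div_of_le (by norm_num) (by linarith)
  rw [partialSum_sub f hKM, abs_mul, abs_two]
  have hre := Complex.abs_re_le_norm
    (∑ k ∈ Ioc K M, coef f k * Complex.exp (-(Complex.I * k * t)))
  have := mul_le_mul hfac hint (norm_nonneg _) (by norm_num)
  linarith

lemma coef_eq_fourierCoeff [Fact (0 < 2 * Real.pi)] (f : ℝ → ℝ) (n : ℤ) :
    fourierCoeff (AddCircle.liftIco (2 * Real.pi) 0 fun t => (f t : ℂ)) n = coef f (-n) := by
  rw [fourierCoeff_eq_intervalIntegral _ _ 0, coef, zero_add]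
  have : ∫ t in (0 : ℝ)..(2 * Real.pi), fourier (-n) (t : AddCircle (2 * Real.pi)) •
        AddCircle.liftIco (2 * Real.pi) 0 (fun t => (f t : ℂ)) t
      = ∫ t in (0 : ℝ)..(2 * Real.pi), (f t : ℂ) * Complex.exp (Complex.I * ((-n : ℤ) : ℂ) * t) := by
    refine intervalIntegral.integral_congr_Ioo_of_le Real.two_pi_pos.le fun t ht => ?_
    rw [AddCircle.liftIco_zero_coe_apply (Set.Ioo_subset_Ico_self ht), fourier_coe_apply,
      smul_eq_mul, mul_comm]
    congr 2
    have : (Real.pi : ℂ) ≠ 0 := by exact_mod_cast Real.pi_ne_zero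
    push_cast
    field_simp
  rw [this, Complex.real_smul]
  push_cast
  rfl

/-- Bessel's inequality for the derivative `h` makes the coefficients of `f` summable. -/
lemma summable_coef {f h : ℝ → ℝ} {p : ℕ} (hp : 1 ≤ p) (hm : Measurable h) {C : ℝ}
    (hC : ∀ t, |h t| ≤ C) (hcoef : ∀ k : ℤ, coef h k = (-(Complex.I * k)) ^ p * coef f k) :
    Summable fun n : ℤ => coef f n := by
  have : Fact (0 < 2 * Real.pi) := ⟨Real.two_pi_pos⟩
  have hL2 : MemLp (fun t => (h t : ℂ)) 2 (volume.restrict (Set.Ioc 0 (0 + 2 * Real.pi))) :=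
    MemLp.of_bound (Complex.measurable_ofReal.comp hm).aestronglyMeasurable C
      (Filter.Eventually.of_forall fun t => by
        rw [Complex.norm_real, Real.norm_eq_abs]; exact hC t)
  have hsq : Summable fun n : ℤ => ‖coef h (-n)‖ ^ 2 := by
    have := (hasSum_sq_fourierCoeffOn (lt_add_of_pos_right 0 Real.two_pi_pos) hL2).summable
    refine this.congr fun n => ?_
    rw [← coef_eq_fourierCoeff, fourierCoeff_liftIco_eq]
  have hsq' : Summable fun n : ℤ => ‖coef h n‖ ^ 2 := by
    have := (Equiv.neg ℤ).summable_iff.2 hsq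
    simpa [Function.comp_def] using this
  have hinv : Summable fun n : ℤ => 1 / (n : ℝ) ^ 2 := Real.summable_one_div_int_pow.2 (by norm_num)
  have hz : Summable fun n : ℤ => if n = 0 then ‖coef f 0‖ else 0 :=
    (hasSum_ite_eq 0 _).summable
  refine Summable.of_norm_bounded ((hsq'.add hinv).add hz) fun n => ?_
  by_cases hn : n = 0
  · subst hn
    simp
  · have hn1 : (1 : ℝ) ≤ |(n : ℝ)| := by exact_mod_cast Int.one_le_abs hn
    have h1 : |(n : ℝ)| * ‖coef f n‖ ≤ ‖coef h n‖ := by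
      rw [coef_norm_eq hcoef]
      gcongr
      exact le_self_pow₀ hn1 (by omega)
    have h2 : ‖coef f n‖ ≤ ‖coef h n‖ * (1 / |(n : ℝ)|) := by
      rw [mul_one_div, le_div_iff₀ (by linarith)]
      linarith
    have h3 : (1 / |(n : ℝ)|) ^ 2 = 1 / (n : ℝ) ^ 2 := by rw [div_pow, sq_abs, one_pow]
    rw [if_neg hn, add_zero, ← h3]
    nlinarith [sq_nonneg (‖coef h n‖ - 1 / |(n : ℝ)|), sq_nonneg ‖coef h n‖,
      sq_nonneg (1 / |(n : ℝ)|)]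

lemma tendsto_partialSum {f : ℝ → ℝ} (hf : ContinuousOn f period) (h0 : f 0 = f (2 * Real.pi))
    (hsum : Summable fun n : ℤ => coef f n) {t : ℝ} (ht : t ∈ period) :
    Filter.Tendsto (fun M => partialSum f M t) Filter.atTop (nhds (f t)) := by
  have : Fact (0 < 2 * Real.pi) := ⟨Real.two_pi_pos⟩
  have hcont : Continuous (AddCircle.liftIco (2 * Real.pi) 0 fun t => (f t : ℂ)) :=
    AddCircle.liftIco_zero_continuous (by rw [h0])
      (Complex.continuous_ofReal.comp_continuousOn hf)
  have hval : AddCircle.liftIco (2 * Real.pi) 0 (fun t => (f t : ℂ)) (t : AddCircle (2 * Real.pi))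
      = f t := by
    rcases ht.2.lt_or_eq with h | h
    · exact AddCircle.liftIco_zero_coe_apply ⟨ht.1, h⟩
    · have : (t : AddCircle (2 * Real.pi)) = ((0 : ℝ) : AddCircle (2 * Real.pi)) := by
        rw [h, AddCircle.coe_period]; rfl
      rw [this, AddCircle.liftIco_zero_coe_apply ⟨le_rfl, Real.two_pi_pos⟩, h, h0]
  have hS : Summable (fourierCoeff (⟨_, hcont⟩ : C(AddCircle (2 * Real.pi), ℂ))) := by
    have := (Equiv.neg ℤ).summable_iff.2 hsum
    refine this.congr fun n => ?_
    exact (coef_eq_fourierCoeff f n).symm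
  have hs := has_pointwise_sum_fourier_series_of_summable hS (t : AddCircle (2 * Real.pi))
  have hterm : ∀ n : ℤ, fourierCoeff (⟨_, hcont⟩ : C(AddCircle (2 * Real.pi), ℂ)) n •
      fourier n (t : AddCircle (2 * Real.pi)) = coef f (-n) * Complex.exp (Complex.I * n * t) := by
    intro n
    have := coef_eq_fourierCoeff f n
    simp only [ContinuousMap.coe_mk, smul_eq_mul] at this ⊢
    rw [this, fourier_coe_apply]
    congr 2
    have : (Real.pi : ℂ) ≠ 0 := by exact_mod_cast Real.pi_ne_zero
    push_cast
    field_simp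
  rw [funext hterm, ContinuousMap.coe_mk, hval] at hs
  have h1 := hs.nat_add_neg.tendsto_sum_nat
  have h2 := (Complex.continuous_re.tendsto _).comp (h1.comp (Filter.tendsto_add_atTop_nat 1))
  have h3 : ∀ M : ℕ, (∑ n ∈ range (M + 1), (coef f (-(n : ℤ)) * Complex.exp (Complex.I * (n : ℤ) * t)
      + coef f (-(-(n : ℤ))) * Complex.exp (Complex.I * (-(n : ℤ) : ℤ) * t))).re
      = partialSum f M t + (coef f 0).re := by
    intro M
    have hn : ∀ n : ℕ, (coef f (-(n : ℤ)) * Complex.exp (Complex.I * (n : ℤ) * t)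
      + coef f (-(-(n : ℤ))) * Complex.exp (Complex.I * (-(n : ℤ) : ℤ) * t)).re
      = 2 * (coef f n * Complex.exp (-(Complex.I * n * t))).re := by
      intro n
      have : coef f (-(n : ℤ)) * Complex.exp (Complex.I * (n : ℤ) * t)
          = (starRingEnd ℂ) (coef f n * Complex.exp (-(Complex.I * n * t))) := by
        rw [coef_neg, map_mul, ← Complex.exp_conj]
        simp
      rw [this, Complex.add_re, Complex.conj_re, neg_neg, two_mul]
      congr 4
      push_cast
      ring
    rw [Complex.re_sum, partialSum, sum_range_succ', sum_range_succ' _ M, add_assoc]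
    congr 1
    · refine sum_congr rfl fun n _ => ?_
      rw [hn, ← partialSum_term f (Nat.succ_ne_zero n)]
    · rw [hn]
      simp [cosEntry, two_mul]
  have h4 : Filter.Tendsto (fun M => partialSum f M t + (coef f 0).re) Filter.atTop
      (nhds (f t + (coef f 0).re)) := by
    refine (h2.congr fun M => ?_).trans (le_of_eq ?_)
    · exact h3 M
    · simp
  simpa using h4.sub_const (coef f 0).re

/-- The partial sums of the Fourier series of `f` approximate `f` uniformly to the order
`log K / K ^ (q + 1)`. -/
theorem HasLipschitzDeriv.exists_abs_sub_partialSum_le {q : ℕ} {f : ℝ → ℝ}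
    (hf : HasLipschitzDeriv q f) (hp : PeriodicDerivs q f) :
    ∃ B : ℝ, 0 ≤ B ∧ ∀ K : ℕ, 2 ≤ K → ∀ t ∈ period,
      |f t - partialSum f K t| ≤ B * (Real.log K / (K : ℝ) ^ (q + 1)) := by
  obtain ⟨h, hm, ⟨C, hC0, hC⟩, hcoef⟩ := hf.exists_bounded_deriv hp
  obtain ⟨A, hA0, hA⟩ := exists_integral_norm_tailKernel_le
  refine ⟨C * A, by positivity, fun K hK t ht => ?_⟩
  have hlim := tendsto_partialSum (by simpa using hf.continuousOn (Nat.zero_le q))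
    (by simpa using hp 0 (Nat.zero_le q)) (summable_coef (by omega) hm hC hcoef) ht
  refine le_of_tendsto ((hlim.sub_const (partialSum f K t)).abs) ?_
  filter_upwards [Filter.eventually_ge_atTop K] with M hM
  refine (abs_partialSum_sub_le hm hC hcoef hM t).trans ?_
  rw [mul_assoc]
  exact mul_le_mul_of_nonneg_left (hA _ _ _ hK (by omega) t) hC0

end TrigSIP

/-! ### Nonnegative polynomials on the unit circle -/

namespace TrigSIP

open Polynomial Finset

lemma sub_sq_eq_of_norm_eq_one {z w : ℂ} (hz : ‖z‖ = 1) (hw : ‖w‖ = 1) :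
    (z - w) ^ 2 = -(z * w) * ((‖z - w‖ ^ 2 : ℝ) : ℂ) := by
  have hz' : z * (starRingEnd ℂ) z = 1 := by rw [Complex.mul_conj']; simp [hz]
  have hw' : w * (starRingEnd ℂ) w = 1 := by rw [Complex.mul_conj']; simp [hw]
  push_cast
  rw [← Complex.mul_conj', map_sub]
  linear_combination (w * (z - w)) * hz' - (z * (z - w)) * hw'

lemma hasDerivAt_mul_exp (z₀ : ℂ) (c : ℂ) :
    HasDerivAt (fun t : ℝ => z₀ * Complex.exp (c * t)) (z₀ * c) 0 := by
  have h1 : HasDerivAt (fun t : ℝ => c * (t : ℂ)) (c * 1) 0 :=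
    (Complex.ofRealCLM.hasDerivAt (x := (0 : ℝ))).const_mul c
  have := (h1.cexp).const_mul z₀
  simpa using this

/-- At a point of the unit circle where the nonnegative function `P(z) z⁻ᴺ` attains the value `0`,
the polynomial `P` has a double root: the function has a minimum there. -/
lemma sq_dvd_of_nonneg_on_circle {P : ℂ[X]} {N : ℕ}
    (hP : ∀ z : ℂ, ‖z‖ = 1 → ∃ r : ℝ, 0 ≤ r ∧ P.eval z = r * z ^ N)
    {z₀ : ℂ} (hz₀ : ‖z₀‖ = 1) (h0 : P.eval z₀ = 0) : (X - C z₀) ^ 2 ∣ P := by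
  have hne : z₀ ≠ 0 := by rintro rfl; simp at hz₀
  set γ : ℝ → ℂ := fun t => z₀ * Complex.exp (Complex.I * t) with hγ
  have hγn : ∀ t, ‖γ t‖ = 1 := fun t => by
    rw [hγ, norm_mul, hz₀, Complex.norm_exp_I_mul_ofReal, one_mul]
  have hγ0 : γ 0 = z₀ := by simp [hγ]
  set F : ℝ → ℂ := fun t => P.eval (γ t) * (γ t)⁻¹ ^ N with hF
  have hFr : ∀ t, ∃ r : ℝ, 0 ≤ r ∧ F t = r := fun t => by
    obtain ⟨r, hr, h⟩ := hP (γ t) (hγn t)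
    refine ⟨r, hr, ?_⟩
    have : γ t ≠ 0 := by rw [← norm_pos_iff, hγn]; norm_num
    simp only [hF]
    rw [h, mul_assoc, ← mul_pow, mul_inv_cancel₀ this, one_pow, mul_one]
  have hF0 : F 0 = 0 := by simp [hF, hγ0, h0]
  have hγd : HasDerivAt γ (z₀ * Complex.I) 0 := hasDerivAt_mul_exp z₀ Complex.I
  have hd1 : HasDerivAt (fun t => P.eval (γ t)) (P.derivative.eval z₀ * (z₀ * Complex.I)) 0 := by
    have := (P.hasDerivAt (γ 0)).comp (0 : ℝ) hγd
    rwa [hγ0] at this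
  have hd2 : DifferentiableAt ℝ (fun t => (γ t)⁻¹ ^ N) 0 :=
    (hγd.differentiableAt.inv (by rwa [hγ0])).pow N
  have hd : HasDerivAt F (P.derivative.eval z₀ * (z₀ * Complex.I) * (z₀⁻¹) ^ N) 0 := by
    have := hd1.mul hd2.hasDerivAt
    simp only [hγ0, h0, zero_mul, add_zero] at this
    exact this
  set D := P.derivative.eval z₀ * (z₀ * Complex.I) * (z₀⁻¹) ^ N
  have hre : D.re = 0 := by
    have h1 : HasDerivAt (fun t => (F t).re) D.re 0 :=
      (Complex.reCLM.hasFDerivAt.comp_hasDerivAt (0 : ℝ) hd)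
    refine IsLocalMin.hasDerivAt_eq_zero (Filter.Eventually.of_forall fun t => ?_) h1
    obtain ⟨r, hr, h⟩ := hFr t
    simp [hF0, h, hr]
  have him : D.im = 0 := by
    have h1 : HasDerivAt (fun t => (F t).im) D.im 0 :=
      (Complex.imCLM.hasFDerivAt.comp_hasDerivAt (0 : ℝ) hd)
    have h2 : (fun t => (F t).im) = fun _ => 0 := by
      ext t
      obtain ⟨r, hr, h⟩ := hFr t
      simp [h]
    rw [h2] at h1
    exact h1.unique (hasDerivAt_const _ _)
  have hD : D = 0 := Complex.ext hre him
  have hroot : P.derivative.eval z₀ = 0 := by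
    rcases mul_eq_zero.1 hD with h | h
    · exact (mul_eq_zero.1 h).resolve_right (mul_ne_zero hne Complex.I_ne_zero)
    · exact absurd h (pow_ne_zero _ (inv_ne_zero hne))
  by_cases hP0 : P = 0
  · rw [hP0]; exact dvd_zero _
  · rw [← le_rootMultiplicity_iff hP0]
    exact (one_lt_rootMultiplicity_iff_isRoot hP0).2 ⟨h0, hroot⟩

/-- A weak form of the Fejér–Riesz theorem: if `P(z) z⁻ᴷ` is nonnegative on the unit circle, where
`P` is a polynomial of degree at most `2K`, then it is a sum of squares `|Q(z)|²` of polynomials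
of degree at most `K`. Subtracting the minimum creates a double root `z₀` on the circle, and
dividing by `|z - z₀|²` lowers `K`. -/
theorem exists_sum_norm_sq_eq (K : ℕ) : ∀ P : ℂ[X], P.natDegree ≤ 2 * K →
    (∀ z : ℂ, ‖z‖ = 1 → ∃ r : ℝ, 0 ≤ r ∧ P.eval z = r * z ^ K) →
    ∃ m : ℕ, ∃ Q : Fin m → ℂ[X], (∀ i, (Q i).natDegree ≤ K) ∧
      ∀ z : ℂ, ‖z‖ = 1 → P.eval z = ((∑ i, ‖(Q i).eval z‖ ^ 2 : ℝ) : ℂ) * z ^ K := by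
  induction K with
  | zero =>
    intro P hdeg hP
    obtain ⟨c, rfl⟩ := natDegree_eq_zero.1 (Nat.le_zero.1 hdeg)
    obtain ⟨r, hr, h⟩ := hP 1 norm_one
    refine ⟨1, fun _ => C (Real.sqrt r : ℂ), fun _ => by simp, fun z _ => ?_⟩
    simp only [eval_C, mul_one, pow_zero] at h ⊢
    rw [h]
    simp [Real.sq_sqrt hr]
  | succ K ih =>
    intro P hdeg hP
    have hnorm : ∀ z : ℂ, ‖z‖ = 1 → P.eval z = (‖P.eval z‖ : ℂ) * z ^ (K + 1) := by
      intro z hz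
      obtain ⟨r, hr, h⟩ := hP z hz
      have : ‖P.eval z‖ = r := by
        rw [h, norm_mul, norm_pow, hz, one_pow, mul_one, Complex.norm_real,
          Real.norm_of_nonneg hr]
      rw [this, h]
    obtain ⟨z₀, hz₀, hmin⟩ := (isCompact_sphere (0 : ℂ) 1).exists_isMinOn
      ⟨1, by simp⟩ (P.continuous.norm.continuousOn)
    have hz₀ : ‖z₀‖ = 1 := by simpa using hz₀
    set μ := ‖P.eval z₀‖ with hμ
    have hμ0 : 0 ≤ μ := norm_nonneg _
    have hmin' : ∀ z : ℂ, ‖z‖ = 1 → μ ≤ ‖P.eval z‖ := fun z hz => hmin (by simpa using hz)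
    have hsub : ∀ z : ℂ, ‖z‖ = 1 →
        (P - C (μ : ℂ) * X ^ (K + 1)).eval z = ((‖P.eval z‖ - μ : ℝ) : ℂ) * z ^ (K + 1) := by
      intro z hz
      simp only [eval_sub, eval_mul, eval_C, eval_pow, eval_X]
      push_cast
      linear_combination hnorm z hz
    obtain ⟨P₁, hP₁⟩ := sq_dvd_of_nonneg_on_circle (N := K + 1)
      (fun z hz => ⟨_, sub_nonneg.2 (hmin' z hz), hsub z hz⟩) hz₀
      (by rw [hsub z₀ hz₀, hμ, sub_self]; simp)
    have hdegsub : (P - C (μ : ℂ) * X ^ (K + 1)).natDegree ≤ 2 * (K + 1) :=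
      (natDegree_sub_le _ _).trans (max_le hdeg ((natDegree_C_mul_X_pow_le _ _).trans (by omega)))
    have hdeg₁ : P₁.natDegree ≤ 2 * K := by
      by_cases h : P₁ = 0
      · simp [h]
      · rw [hP₁, natDegree_mul (pow_ne_zero _ (X_sub_C_ne_zero _)) h, natDegree_pow,
          natDegree_X_sub_C] at hdegsub
        omega
    have hfac : ∀ z : ℂ, ‖z‖ = 1 → ((‖z - z₀‖ ^ 2 : ℝ) : ℂ) * (C (-z₀) * P₁).eval z * z
        = ((‖P.eval z‖ - μ : ℝ) : ℂ) * z ^ (K + 1) := by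
      intro z hz
      rw [← hsub z hz, hP₁]
      simp only [eval_mul, eval_C, eval_pow, eval_sub, eval_X]
      rw [sub_sq_eq_of_norm_eq_one hz hz₀]
      ring
    have hP₂ : ∀ z : ℂ, ‖z‖ = 1 → z ≠ z₀ →
        (C (-z₀) * P₁).eval z = (‖(C (-z₀) * P₁).eval z‖ : ℂ) * z ^ K := by
      intro z hz hzz
      have hz0 : z ≠ 0 := by rintro rfl; simp at hz
      have hd : 0 < ‖z - z₀‖ ^ 2 := by
        have := norm_pos_iff.2 (sub_ne_zero.2 hzz)
        positivity
      have hd' : ((‖z - z₀‖ ^ 2 : ℝ) : ℂ) ≠ 0 := by exact_mod_cast hd.ne'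
      have h1 : (C (-z₀) * P₁).eval z
          = (((‖P.eval z‖ - μ) / ‖z - z₀‖ ^ 2 : ℝ) : ℂ) * z ^ K := by
        have := hfac z hz
        rw [pow_succ z K, ← mul_assoc (((‖P.eval z‖ - μ : ℝ) : ℂ))] at this
        have := mul_right_cancel₀ hz0 this
        rw [Complex.ofReal_div, div_mul_eq_mul_div, eq_div_iff hd', mul_comm]
        exact this
      have h2 : ‖(C (-z₀) * P₁).eval z‖ = (‖P.eval z‖ - μ) / ‖z - z₀‖ ^ 2 := by
        rw [h1, norm_mul, norm_pow, hz, one_pow, mul_one, Complex.norm_real,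
          Real.norm_of_nonneg (div_nonneg (sub_nonneg.2 (hmin' z hz)) hd.le)]
      rw [h2]
      exact h1
    -- The identity extends to `z₀` by continuity along the circle.
    have hP₂' : (C (-z₀) * P₁).eval z₀ = (‖(C (-z₀) * P₁).eval z₀‖ : ℂ) * z₀ ^ K := by
      set γ : ℝ → ℂ := fun t => z₀ * Complex.exp (Complex.I * t) with hγ
      have hγc : Continuous γ := by fun_prop
      have hγ0 : γ 0 = z₀ := by simp [hγ]
      have hc : Continuous fun z : ℂ => (C (-z₀) * P₁).eval z
          - (‖(C (-z₀) * P₁).eval z‖ : ℂ) * z ^ K :=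
        (Polynomial.continuous _).sub ((Complex.continuous_ofReal.comp
          (Polynomial.continuous _).norm).mul (continuous_id.pow K))
      have ht : Filter.Tendsto (fun t => (C (-z₀) * P₁).eval (γ t)
          - (‖(C (-z₀) * P₁).eval (γ t)‖ : ℂ) * (γ t) ^ K) (nhdsWithin 0 (Set.Ioi 0))
          (nhds ((C (-z₀) * P₁).eval (γ 0) - (‖(C (-z₀) * P₁).eval (γ 0)‖ : ℂ) * (γ 0) ^ K)) :=
        ((hc.comp hγc).tendsto 0).mono_left nhdsWithin_le_nhds
      have hev : ∀ᶠ t : ℝ in nhdsWithin 0 (Set.Ioi 0), (C (-z₀) * P₁).eval (γ t)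
          - (‖(C (-z₀) * P₁).eval (γ t)‖ : ℂ) * (γ t) ^ K = 0 := by
        filter_upwards [Ioo_mem_nhdsGT Real.pi_pos] with t ht
        refine sub_eq_zero.2 (hP₂ _ ?_ fun h => ?_)
        · rw [hγ, norm_mul, hz₀, Complex.norm_exp_I_mul_ofReal, one_mul]
        · have hne : z₀ ≠ 0 := by rintro rfl; simp at hz₀
          have h1 : Complex.exp (t * Complex.I) = 1 := by
            rw [mul_comm]
            exact mul_left_cancel₀ hne (by rw [mul_one]; exact h)
          have h2 := congrArg Complex.im h1
          rw [Complex.exp_ofReal_mul_I_im] at h2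
          exact (Real.sin_pos_of_pos_of_lt_pi ht.1 ht.2).ne' h2
      have := tendsto_nhds_unique ((tendsto_const_nhds (x := (0 : ℂ))).congr'
        (hev.mono fun t h => h.symm)) ht
      rw [hγ0] at this
      exact sub_eq_zero.1 this.symm
    obtain ⟨m, Q, hQ, hQe⟩ := ih (C (-z₀) * P₁)
      ((natDegree_C_mul_le _ _).trans hdeg₁) (fun z hz => ⟨‖(C (-z₀) * P₁).eval z‖, norm_nonneg _, by
        by_cases h : z = z₀
        · rw [h]; exact hP₂'
        · exact hP₂ z hz h⟩)
    refine ⟨m + 1, Fin.cons (C (Real.sqrt μ : ℂ)) fun i => (X - C z₀) * Q i, fun i => ?_,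
      fun z hz => ?_⟩
    · refine Fin.cases (by simp) (fun i => ?_) i
      rw [Fin.cons_succ]
      refine natDegree_mul_le.trans ?_
      rw [natDegree_X_sub_C]
      have := hQ i
      omega
    · rw [Fin.sum_univ_succ]
      simp only [Fin.cons_zero, Fin.cons_succ, eval_C, eval_mul, eval_sub, eval_X, norm_mul,
        Complex.norm_real, Real.norm_of_nonneg (Real.sqrt_nonneg μ), Real.sq_sqrt hμ0, mul_pow]
      rw [← mul_sum]
      have h1 := hfac z hz
      rw [hQe z hz] at h1
      have h2 := hnorm z hz
      rw [h2]
      push_cast at h1 ⊢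
      linear_combination -h1

end TrigSIP

/-! ### The semidefinite representation -/

namespace TrigSIP

open Polynomial Finset Matrix

lemma cos_add_sin_eq (α β : ℝ) {K k : ℕ} (hk : k ≤ K) (t : ℝ) :
    ((α : ℂ) - Complex.I * β) / 2 * Complex.exp (t * Complex.I) ^ (K + k)
        + ((α : ℂ) + Complex.I * β) / 2 * Complex.exp (t * Complex.I) ^ (K - k)
      = ((α * Real.cos (k * t) + β * Real.sin (k * t) : ℝ) : ℂ)
        * Complex.exp (t * Complex.I) ^ K := by
  obtain ⟨r, rfl⟩ := Nat.exists_eq_add_of_le hk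
  have hz : Complex.exp (t * Complex.I) ^ k = Real.cos (k * t) + Real.sin (k * t) * Complex.I := by
    rw [← Complex.exp_nat_mul, ← mul_assoc]
    have := Complex.exp_mul_I (k * t)
    rw [this]
    push_cast
    rfl
  have hcs : (Real.cos (k * t) : ℂ) ^ 2 + (Real.sin (k * t) : ℂ) ^ 2 = 1 := by
    exact_mod_cast Real.cos_sq_add_sin_sq (k * t)
  rw [Nat.add_sub_cancel_left, pow_add, pow_add, hz, Complex.ofReal_add, Complex.ofReal_mul,
    Complex.ofReal_mul]
  set w := Complex.exp (t * Complex.I) ^ r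
  set c := (Real.cos (k * t) : ℂ)
  set s := (Real.sin (k * t) : ℂ)
  have hzz : (c + s * Complex.I) * (c - s * Complex.I) = 1 := by
    linear_combination hcs - s ^ 2 * Complex.I_sq
  linear_combination (-((α : ℂ) + Complex.I * β) / 2 * w) * hzz
    - w * (c + s * Complex.I) * β * s * Complex.I_sq

/-- The polynomial `z ↦ zᴷ ∑_{k ≤ K} (α_k cos kt + β_k sin kt)`, `z = e^{it}`. -/
noncomputable def circlePoly (K : ℕ) (α β : ℕ → ℝ) : ℂ[X] :=
  ∑ k ∈ range (K + 1), (C (((α k : ℂ) - Complex.I * β k) / 2) * X ^ (K + k)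
    + C (((α k : ℂ) + Complex.I * β k) / 2) * X ^ (K - k))

lemma natDegree_circlePoly_le (K : ℕ) (α β : ℕ → ℝ) :
    (circlePoly K α β).natDegree ≤ 2 * K := by
  refine natDegree_sum_le_of_forall_le _ _ fun k hk => ?_
  have := mem_range.1 hk
  refine (natDegree_add_le _ _).trans (max_le ?_ ?_)
  · exact (natDegree_C_mul_X_pow_le _ _).trans (by omega)
  · exact (natDegree_C_mul_X_pow_le _ _).trans (by omega)

lemma eval_circlePoly (K : ℕ) (α β : ℕ → ℝ) (t : ℝ) :
    (circlePoly K α β).eval (Complex.exp (t * Complex.I))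
      = ((∑ k ∈ range (K + 1), (α k * Real.cos (k * t) + β k * Real.sin (k * t)) : ℝ) : ℂ)
        * Complex.exp (t * Complex.I) ^ K := by
  rw [circlePoly, eval_finsetSum, Complex.ofReal_sum, sum_mul]
  refine sum_congr rfl fun k hk => ?_
  rw [← cos_add_sin_eq (α k) (β k) (Nat.lt_succ_iff.1 (mem_range.1 hk)) t]
  simp

lemma coeff_circlePoly_add (K : ℕ) (α β : ℕ → ℝ) {k : ℕ} (hk1 : 1 ≤ k) (hk : k ≤ K) :
    (circlePoly K α β).coeff (K + k) = ((α k : ℂ) - Complex.I * β k) / 2 := by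
  rw [circlePoly, finsetSum_coeff, sum_eq_single k]
  · rw [coeff_add, coeff_C_mul, coeff_C_mul, coeff_X_pow, coeff_X_pow, if_pos rfl,
      if_neg (by omega)]
    ring
  · intro j _ hj
    rw [coeff_add, coeff_C_mul, coeff_C_mul, coeff_X_pow, coeff_X_pow, if_neg (by omega),
      if_neg (by omega)]
    ring
  · intro h
    exact absurd (mem_range.2 (by omega)) h

lemma coeff_circlePoly_self (K : ℕ) (α β : ℕ → ℝ) : (circlePoly K α β).coeff K = α 0 := by
  rw [circlePoly, finsetSum_coeff, sum_eq_single 0]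
  · simp
    ring
  · intro j hj hj0
    have := mem_range.1 hj
    rw [coeff_add, coeff_C_mul, coeff_C_mul, coeff_X_pow, coeff_X_pow, if_neg (by omega),
      if_neg (by omega)]
    ring
  · intro h
    exact absurd (mem_range.2 (by omega)) h

/-- The coefficients of a trigonometric polynomial are determined by its values. -/
lemma eq_zero_of_trig_sum_eq_zero {K : ℕ} {α β : ℕ → ℝ}
    (h : ∀ t : ℝ, ∑ k ∈ range (K + 1), (α k * Real.cos (k * t) + β k * Real.sin (k * t)) = 0) :
    (∀ k ≤ K, α k = 0) ∧ ∀ k, 1 ≤ k → k ≤ K → β k = 0 := by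
  have hP : circlePoly K α β = 0 := by
    refine eq_zero_of_infinite_isRoot _ (Set.infinite_of_injOn_mapsTo
      (f := fun t : ℝ => Complex.exp (t * Complex.I)) (s := Set.Ioc 0 Real.pi) ?_ ?_ ?_)
    · intro s hs t ht hst
      have h1 : ∀ r ∈ Set.Ioc 0 Real.pi, toIocMod Real.two_pi_pos (-Real.pi) r = r :=
        fun r hr => (toIocMod_eq_self _).2
          ⟨by linarith [hr.1, Real.pi_pos], by linarith [hr.2, Real.pi_pos]⟩
      have := congrArg Complex.arg hst
      simpa only [Complex.arg_exp_mul_I, h1 s hs, h1 t ht] using this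
    · intro t _
      have := eval_circlePoly K α β t
      rw [h t] at this
      simpa using this
    · exact Set.Ioc_infinite Real.pi_pos
  have hpos : ∀ k, 1 ≤ k → k ≤ K → α k = 0 ∧ β k = 0 := by
    intro k hk1 hk
    have h1 := coeff_circlePoly_add K α β hk1 hk
    rw [hP, coeff_zero] at h1
    have h2 : ((α k : ℂ) - Complex.I * β k) = 0 := by linear_combination -2 * h1
    have hre := congrArg Complex.re h2
    have him := congrArg Complex.im h2
    simp at hre him
    exact ⟨hre, him⟩
  refine ⟨fun k hk => ?_, fun k hk1 hk => (hpos k hk1 hk).2⟩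
  rcases Nat.eq_zero_or_pos k with rfl | hk1
  · have h1 := coeff_circlePoly_self K α β
    rw [hP, coeff_zero] at h1
    exact_mod_cast h1.symm
  · exact (hpos k hk1 hk).1

lemma sum_cos_mul_symToeplitz (K : ℕ) (l m : Fin (K + 1)) (t : ℝ) :
    ∑ k ∈ range (K + 1), Real.cos (k * t) * symToeplitz K k l m
      = Real.cos (l * t) * Real.cos (m * t) + Real.sin (l * t) * Real.sin (m * t) := by
  rw [← Real.cos_sub]
  simp only [symToeplitz, of_apply, Int.abs_eq_natAbs]
  have hl := l.2
  have hm := m.2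
  rw [sum_eq_single ((l : ℤ) - (m : ℤ)).natAbs]
  · rw [if_pos (by omega), mul_one]
    rcases le_total (m : ℕ) (l : ℕ) with h | h
    · have : (((l : ℤ) - (m : ℤ)).natAbs : ℝ) = (l : ℝ) - m := by
        rw [← Nat.cast_sub (R := ℝ) h, Nat.cast_inj]; omega
      rw [this, sub_mul]
    · have : (((l : ℤ) - (m : ℤ)).natAbs : ℝ) = (m : ℝ) - l := by
        rw [← Nat.cast_sub (R := ℝ) h, Nat.cast_inj]; omega
      rw [this, ← Real.cos_neg]
      congr 1
      ring
  · intro k _ hk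
    rw [if_neg (by omega), mul_zero]
  · intro h
    exact absurd (mem_range.2 (by omega)) h

lemma sum_sin_mul_skewToeplitz (K : ℕ) (l m : Fin (K + 1)) (t : ℝ) :
    ∑ k ∈ range (K + 1), Real.sin (k * t) * skewToeplitz K k l m
      = Real.sin (m * t) * Real.cos (l * t) - Real.cos (m * t) * Real.sin (l * t) := by
  rw [← Real.sin_sub]
  simp only [skewToeplitz, of_apply]
  have hl := l.2
  have hm := m.2
  rw [sum_eq_single ((l : ℤ) - (m : ℤ)).natAbs]
  · rcases lt_or_ge (m : ℕ) (l : ℕ) with h | h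
    · have : (((l : ℤ) - (m : ℤ)).natAbs : ℝ) = (l : ℝ) - m := by
        rw [← Nat.cast_sub (R := ℝ) h.le, Nat.cast_inj]; omega
      rw [if_neg (by omega), if_pos (by omega), this, mul_neg_one, ← Real.sin_neg]
      congr 1
      ring
    · have : (((l : ℤ) - (m : ℤ)).natAbs : ℝ) = (m : ℝ) - l := by
        rw [← Nat.cast_sub (R := ℝ) h, Nat.cast_inj]; omega
      rw [if_pos (by omega), this, mul_one, sub_mul]
  · intro k _ hk
    rw [if_neg (by omega), if_neg (by omega), mul_zero]
  · intro h
    exact absurd (mem_range.2 (by omega)) h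

/-- The vector of the values `cos lt` and `sin lt`; its product with `(Re u, Im u)` is the real
part of `∑ u_l e^{-ilt}`. -/
noncomputable def reVec (K : ℕ) (t : ℝ) : Fin (K + 1) ⊕ Fin (K + 1) → ℝ :=
  Sum.elim (fun l => Real.cos (l * t)) fun l => Real.sin (l * t)

/-- The vector of the values `-sin lt` and `cos lt`; its product with `(Re u, Im u)` is the
imaginary part of `∑ u_l e^{-ilt}`. -/
noncomputable def imVec (K : ℕ) (t : ℝ) : Fin (K + 1) ⊕ Fin (K + 1) → ℝ :=
  Sum.elim (fun l => -Real.sin (l * t)) fun l => Real.cos (l * t)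

lemma sum_block_eq (K : ℕ) (t : ℝ) :
    ∑ k ∈ range (K + 1), (Real.cos (k * t) • blockSym K k - Real.sin (k * t) • blockSkew K k)
      = vecMulVec (reVec K t) (reVec K t) + vecMulVec (imVec K t) (imVec K t) := by
  ext i j
  rw [Matrix.sum_apply]
  simp only [Matrix.sub_apply, Matrix.smul_apply, Matrix.add_apply, vecMulVec_apply, smul_eq_mul,
    sum_sub_distrib, blockSym, blockSkew, reVec, imVec]
  rcases i with l | l <;> rcases j with m | m <;>
    simp only [fromBlocks_apply₁₁, fromBlocks_apply₁₂, fromBlocks_apply₂₁, fromBlocks_apply₂₂,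
      Matrix.zero_apply, Matrix.neg_apply, mul_zero, mul_neg, sum_const_zero, sum_neg_distrib,
      Sum.elim_inl, Sum.elim_inr, sum_cos_mul_symToeplitz, sum_sin_mul_skewToeplitz] <;> ring

/-- The trigonometric polynomial with coefficients `Tr(blockSym K k * Y)` and
`-Tr(blockSkew K k * Y)` is a sum of two values of the quadratic form `Y`. -/
lemma sum_trace_eq (K : ℕ) (t : ℝ)
    (Y : Matrix (Fin (K + 1) ⊕ Fin (K + 1)) (Fin (K + 1) ⊕ Fin (K + 1)) ℝ) :
    ∑ k ∈ range (K + 1), ((blockSym K k * Y).trace * Real.cos (k * t)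
        + -(blockSkew K k * Y).trace * Real.sin (k * t))
      = reVec K t ⬝ᵥ Y *ᵥ reVec K t + imVec K t ⬝ᵥ Y *ᵥ imVec K t := by
  have h1 : ∀ v : Fin (K + 1) ⊕ Fin (K + 1) → ℝ,
      v ⬝ᵥ Y *ᵥ v = (vecMulVec v v * Y).trace := by
    intro v
    rw [vecMulVec_mul, trace_vecMulVec, dotProduct_mulVec, dotProduct_comm]
  rw [h1, h1, ← trace_add, ← add_mul, ← sum_block_eq, Finset.sum_mul, trace_sum]
  refine sum_congr rfl fun k _ => ?_
  rw [Matrix.sub_mul, trace_sub, smul_mul_assoc, smul_mul_assoc, trace_smul, trace_smul,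
    smul_eq_mul, smul_eq_mul]
  ring

/-- The real vector `(Re u, Im u)` that encodes the conjugates `u` of the coefficients of `Q`. -/
noncomputable def coeffVec (K : ℕ) (Q : ℂ[X]) : Fin (K + 1) ⊕ Fin (K + 1) → ℝ :=
  Sum.elim (fun l => (Q.coeff l).re) fun l => -(Q.coeff l).im

lemma sq_reVec_add_sq_imVec {K : ℕ} {Q : ℂ[X]} (hQ : Q.natDegree ≤ K) (t : ℝ) :
    (reVec K t ⬝ᵥ coeffVec K Q) ^ 2 + (imVec K t ⬝ᵥ coeffVec K Q) ^ 2
      = ‖Q.eval (Complex.exp (t * Complex.I))‖ ^ 2 := by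
  have he : Q.eval (Complex.exp (t * Complex.I))
      = ∑ l : Fin (K + 1), Q.coeff l * (Real.cos (l * t) + Real.sin (l * t) * Complex.I) := by
    rw [eval_eq_sum_range' (Nat.lt_succ_of_le hQ), Finset.sum_range]
    refine sum_congr rfl fun l _ => ?_
    rw [← Complex.exp_nat_mul, ← mul_assoc]
    have := Complex.exp_mul_I ((l : ℕ) * t)
    rw [this]
    push_cast
    rfl
  have hre : (Q.eval (Complex.exp (t * Complex.I))).re = reVec K t ⬝ᵥ coeffVec K Q := by
    rw [he, Complex.re_sum]
    simp only [dotProduct, reVec, coeffVec, Fintype.sum_sum_type, Sum.elim_inl, Sum.elim_inr]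
    rw [← sum_add_distrib]
    refine sum_congr rfl fun l _ => ?_
    simp only [Complex.mul_re, Complex.add_re, Complex.add_im, Complex.mul_im, Complex.ofReal_re,
      Complex.ofReal_im, Complex.I_re, Complex.I_im]
    ring
  have him : (Q.eval (Complex.exp (t * Complex.I))).im = -(imVec K t ⬝ᵥ coeffVec K Q) := by
    rw [he, Complex.im_sum]
    simp only [dotProduct, imVec, coeffVec, Fintype.sum_sum_type, Sum.elim_inl, Sum.elim_inr]
    rw [← sum_add_distrib, ← sum_neg_distrib]
    refine sum_congr rfl fun l _ => ?_
    simp only [Complex.mul_re, Complex.add_re, Complex.add_im, Complex.mul_im, Complex.ofReal_re,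
      Complex.ofReal_im, Complex.I_re, Complex.I_im]
    ring
  rw [Complex.sq_norm, Complex.normSq_apply, hre, him]
  ring

/-- A nonnegative trigonometric polynomial of degree at most `K` has a positive semidefinite
representation. -/
lemma exists_posSemidef_of_nonneg {K : ℕ} {α β : ℕ → ℝ}
    (h : ∀ t : ℝ, 0 ≤ ∑ k ∈ range (K + 1), (α k * Real.cos (k * t) + β k * Real.sin (k * t))) :
    ∃ Y : Matrix (Fin (K + 1) ⊕ Fin (K + 1)) (Fin (K + 1) ⊕ Fin (K + 1)) ℝ, Y.PosSemidef ∧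
      (∀ k ≤ K, (blockSym K k * Y).trace = α k) ∧
      ∀ k, 1 ≤ k → k ≤ K → (blockSkew K k * Y).trace = -β k := by
  obtain ⟨m, Q, hQ, hQe⟩ := exists_sum_norm_sq_eq K (circlePoly K α β)
    (natDegree_circlePoly_le K α β) (fun z hz => by
      have hz' : z = Complex.exp (z.arg * Complex.I) := by
        have := Complex.norm_mul_exp_arg_mul_I z
        rw [hz] at this
        simpa using this.symm
      refine ⟨_, h z.arg, ?_⟩
      have := eval_circlePoly K α β z.arg
      rwa [← hz'] at this)
  set Y := ∑ i, vecMulVec (coeffVec K (Q i)) (coeffVec K (Q i)) with hY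
  have hquad : ∀ v : Fin (K + 1) ⊕ Fin (K + 1) → ℝ,
      v ⬝ᵥ Y *ᵥ v = ∑ i, (v ⬝ᵥ coeffVec K (Q i)) ^ 2 := by
    intro v
    rw [hY, Matrix.sum_mulVec, dotProduct_sum]
    refine sum_congr rfl fun i _ => ?_
    rw [vecMulVec_mulVec]
    simp only [op_smul_eq_smul, dotProduct_smul, smul_eq_mul]
    rw [dotProduct_comm (coeffVec K (Q i)) v, sq]
  have hzero : ∀ t : ℝ, ∑ k ∈ range (K + 1),
      (((blockSym K k * Y).trace - α k) * Real.cos (k * t)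
        + (-(blockSkew K k * Y).trace - β k) * Real.sin (k * t)) = 0 := by
    intro t
    have h1 := sum_trace_eq K t Y
    rw [hquad, hquad, ← sum_add_distrib] at h1
    simp only [sq_reVec_add_sq_imVec (hQ _)] at h1
    have h2 := hQe _ (Complex.norm_exp_ofReal_mul_I t)
    rw [eval_circlePoly] at h2
    have h3 := mul_right_cancel₀ (pow_ne_zero _ (Complex.exp_ne_zero _)) h2
    have h4 : ∑ k ∈ range (K + 1), (α k * Real.cos (k * t) + β k * Real.sin (k * t))
        = ∑ i, ‖(Q i).eval (Complex.exp (t * Complex.I))‖ ^ 2 := by exact_mod_cast h3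
    rw [← sub_eq_zero.2 (h1.trans h4.symm), ← sum_sub_distrib]
    exact sum_congr rfl fun k _ => by ring
  obtain ⟨hα, hβ⟩ := eq_zero_of_trig_sum_eq_zero hzero
  refine ⟨Y, ?_, fun k hk => by linarith [hα k hk], fun k hk1 hk => by linarith [hβ k hk1 hk]⟩
  refine posSemidef_sum _ fun i _ => ?_
  have := posSemidef_vecMulVec_self_star (coeffVec K (Q i))
  rwa [star_trivial] at this

/-- The `K`-th partial sum of the Fourier series of the slack `a_0 - ∑ a_j x_j`. -/
noncomputable def slackPartialSum {n : ℕ} (a : Fin (n + 1) → ℝ → ℝ) (K : ℕ)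
    (x : EuclideanSpace ℝ (Fin n)) (t : ℝ) : ℝ :=
  partialSum (a 0) K t - ∑ j : Fin n, partialSum (a j.succ) K t * x j

lemma slackPartialSum_eq {n : ℕ} (a : Fin (n + 1) → ℝ → ℝ) (K : ℕ)
    (x : EuclideanSpace ℝ (Fin n)) (t : ℝ) :
    slackPartialSum a K x t = ∑ k ∈ range (K + 1),
      ((cosEntry (a 0) k - ∑ j : Fin n, cosEntry (a j.succ) k * x j) * Real.cos (k * t)
        + (sinEntry (a 0) k - ∑ j : Fin n, sinEntry (a j.succ) k * x j) * Real.sin (k * t)) := by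
  simp only [slackPartialSum, partialSum, sum_mul]
  rw [sum_comm, ← sum_sub_distrib]
  refine sum_congr rfl fun k _ => ?_
  rw [sub_mul, sub_mul, sum_mul, sum_mul]
  simp only [add_mul, sum_add_distrib]
  have h1 : ∀ j : Fin n, cosEntry (a j.succ) k * Real.cos (k * t) * x j
      = cosEntry (a j.succ) k * x j * Real.cos (k * t) := fun j => by ring
  have h2 : ∀ j : Fin n, sinEntry (a j.succ) k * Real.sin (k * t) * x j
      = sinEntry (a j.succ) k * x j * Real.sin (k * t) := fun j => by ring
  simp only [h1, h2]
  ring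

/-- The projection of the feasible set of `(TFP_K)` to the `x`-space: the slack is replaced by the
partial sum of its Fourier series. -/
theorem exists_mem_feasTFP_iff {n : ℕ} (a : Fin (n + 1) → ℝ → ℝ) (K : ℕ)
    (x : EuclideanSpace ℝ (Fin n)) :
    (∃ Y, (x, Y) ∈ feasTFP a K) ↔ ∀ t, 0 ≤ slackPartialSum a K x t := by
  constructor
  · rintro ⟨Y, hY, hc, hs⟩ t
    have h : slackPartialSum a K x t
        = reVec K t ⬝ᵥ Y *ᵥ reVec K t + imVec K t ⬝ᵥ Y *ᵥ imVec K t := by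
      rw [slackPartialSum_eq, ← sum_trace_eq]
      refine sum_congr rfl fun k hk => ?_
      have hk' := Nat.lt_succ_iff.1 (mem_range.1 hk)
      have h1 := hc k hk'
      simp only at h1
      congr 1
      · congr 1
        linarith
      · rcases Nat.eq_zero_or_pos k with rfl | hk1
        · simp
        · have h2 := hs k hk1 hk'
          simp only at h2
          congr 1
          linarith
    rw [h]
    have h1 := hY.dotProduct_mulVec_nonneg (reVec K t)
    have h2 := hY.dotProduct_mulVec_nonneg (imVec K t)
    rw [star_trivial] at h1 h2
    exact add_nonneg h1 h2
  · intro h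
    simp only [slackPartialSum_eq] at h
    obtain ⟨Y, hY, hc, hs⟩ := exists_posSemidef_of_nonneg h
    refine ⟨Y, hY, fun k hk => ?_, fun k hk1 hk => ?_⟩
    · simp only [hc k hk]; ring
    · simp only [hs k hk1 hk]; ring

end TrigSIP

/-! ### Perturbation of the linear program -/

namespace TrigSIP

open Finset Filter

variable {n : ℕ}

lemma lhs_add_smul (a : Fin (n + 1) → ℝ → ℝ) (x y : EuclideanSpace ℝ (Fin n)) (δ t : ℝ) :
    lhs a (x + δ • y) t = lhs a x t + δ * lhs a y t := by
  simp only [lhs, PiLp.add_apply, PiLp.smul_apply, smul_eq_mul, mul_sum]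
  rw [← sum_add_distrib]
  exact sum_congr rfl fun j _ => by ring

lemma cost_add_smul (c : Fin n → ℝ) (x y : EuclideanSpace ℝ (Fin n)) (δ : ℝ) :
    cost c (x + δ • y) = cost c x + δ * cost c y := by
  simp only [cost, PiLp.add_apply, PiLp.smul_apply, smul_eq_mul, mul_sum]
  rw [← sum_add_distrib]
  exact sum_congr rfl fun j _ => by ring

lemma continuous_cost (c : Fin n → ℝ) : Continuous (cost c) := by
  unfold cost
  fun_prop

lemma isClosed_feasP (a : Fin (n + 1) → ℝ → ℝ) : IsClosed (feasP a) := by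
  have : feasP a = ⋂ t ∈ period, {x | lhs a x t ≤ a 0 t} := by
    ext x
    simp [feasP]
  rw [this]
  refine isClosed_biInter fun t _ => isClosed_le ?_ continuous_const
  unfold lhs
  fun_prop

lemma valP_eq {a : Fin (n + 1) → ℝ → ℝ} {c : Fin n → ℝ} {x : EuclideanSpace ℝ (Fin n)}
    (hx : x ∈ solP a c) : valP a c = cost c x :=
  IsLeast.csInf_eq ⟨⟨x, hx.1, rfl⟩, by rintro _ ⟨y, hy, rfl⟩; exact hx.2 y hy⟩

/-- If the set of optimal solutions is bounded, the objective grows at least linearly away from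
it: on the intersection of the feasible set with a sphere that encloses all solutions it exceeds
the optimal value by a positive constant, and by convexity it grows along rays from there on. -/
lemma exists_linear_growth {a : Fin (n + 1) → ℝ → ℝ} {c : Fin n → ℝ}
    {x₀ : EuclideanSpace ℝ (Fin n)} (hx₀ : x₀ ∈ solP a c) {R : ℝ}
    (hR : ∀ x ∈ solP a c, ‖x‖ ≤ R) :
    ∃ κ r : ℝ, 0 < κ ∧ 0 < r ∧ ∀ y ∈ feasP a, r ≤ ‖y - x₀‖ →
      κ * ‖y - x₀‖ ≤ cost c y - cost c x₀ := by
  have hR0 : 0 ≤ R := (norm_nonneg _).trans (hR x₀ hx₀)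
  set r := R + ‖x₀‖ + 1 with hr
  have hr0 : 0 < r := by positivity
  set S := feasP a ∩ Metric.sphere x₀ r with hS
  have hScomp : IsCompact S := (isCompact_sphere x₀ r).inter_left (isClosed_feasP a)
  -- The point of the segment `[x₀, y]` on the sphere is feasible.
  have hseg : ∀ y ∈ feasP a, r ≤ ‖y - x₀‖ → x₀ + (r / ‖y - x₀‖) • (y - x₀) ∈ S := by
    intro y hy hry
    have hpos : 0 < ‖y - x₀‖ := hr0.trans_le hry
    set θ := r / ‖y - x₀‖ with hθ
    have hθ0 : 0 ≤ θ := by positivity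
    have hθ1 : θ ≤ 1 := (div_le_one hpos).2 hry
    refine ⟨fun t ht => ?_, ?_⟩
    · have h1 := hx₀.1 t ht
      have h2 := hy t ht
      have h3 : lhs a (y - x₀) t = lhs a y t - lhs a x₀ t := by
        have := lhs_add_smul a y x₀ (-1) t
        rw [neg_one_smul, ← sub_eq_add_neg] at this
        rw [this]; ring
      rw [lhs_add_smul, h3]
      nlinarith
    · rw [mem_sphere_iff_norm, add_sub_cancel_left, norm_smul, Real.norm_of_nonneg hθ0, hθ,
        div_mul_cancel₀ _ hpos.ne']
  rcases S.eq_empty_or_nonempty with hemp | hne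
  · refine ⟨1, r, one_pos, hr0, fun y hy hry => ?_⟩
    have := hseg y hy hry
    rw [hemp] at this
    exact absurd this (Set.notMem_empty _)
  · obtain ⟨z, hz, hzmin⟩ := hScomp.exists_isMinOn hne (continuous_cost c).continuousOn
    have hgap : 0 < cost c z - cost c x₀ := by
      refine lt_of_le_of_ne (sub_nonneg.2 (hx₀.2 z hz.1)) fun h => ?_
      have hzsol : z ∈ solP a c := ⟨hz.1, fun y hy => by
        have := hx₀.2 y hy
        linarith⟩
      have h1 := hR z hzsol
      have h2 : ‖z - x₀‖ = r := mem_sphere_iff_norm.1 hz.2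
      have h3 := norm_sub_le z x₀
      linarith
    refine ⟨(cost c z - cost c x₀) / r, r, by positivity, hr0, fun y hy hry => ?_⟩
    have hpos : 0 < ‖y - x₀‖ := hr0.trans_le hry
    have h1 : cost c z ≤ cost c (x₀ + (r / ‖y - x₀‖) • (y - x₀)) := hzmin (hseg y hy hry)
    have h3 : cost c (y - x₀) = cost c y - cost c x₀ := by
      have := cost_add_smul c y x₀ (-1)
      rw [neg_one_smul, ← sub_eq_add_neg] at this
      rw [this]; ring
    rw [cost_add_smul, h3] at h1
    have h4 : cost c z - cost c x₀ ≤ r * (cost c y - cost c x₀) / ‖y - x₀‖ := by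
      rw [← div_mul_eq_mul_div]
      linarith
    rw [le_div_iff₀ hpos] at h4
    rw [div_mul_eq_mul_div, div_le_iff₀ hr0]
    linarith

lemma slackPartialSum_periodic (a : Fin (n + 1) → ℝ → ℝ) (K : ℕ)
    (x : EuclideanSpace ℝ (Fin n)) : Function.Periodic (slackPartialSum a K x) (2 * Real.pi) := by
  intro t
  have h : ∀ f : ℝ → ℝ, partialSum f K (t + 2 * Real.pi) = partialSum f K t := by
    intro f
    refine sum_congr rfl fun k _ => ?_
    rw [mul_add, Real.cos_add_nat_mul_two_pi, Real.sin_add_nat_mul_two_pi]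
  simp only [slackPartialSum, h]

lemma slackPartialSum_nonneg_of_period {a : Fin (n + 1) → ℝ → ℝ} {K : ℕ}
    {x : EuclideanSpace ℝ (Fin n)} (h : ∀ t ∈ period, 0 ≤ slackPartialSum a K x t) (t : ℝ) :
    0 ≤ slackPartialSum a K x t := by
  obtain ⟨s, hs, hst⟩ := (slackPartialSum_periodic a K x).exists_mem_Ico₀ Real.two_pi_pos t
  rw [hst]
  exact h s ⟨hs.1, hs.2.le⟩

/-- The error made by replacing the slack by the partial sum of its Fourier series. -/
lemma exists_abs_slack_sub_le {q : ℕ} {a : Fin (n + 1) → ℝ → ℝ}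
    (hsmooth : ∀ j, HasLipschitzDeriv q (a j)) (hper : ∀ j, PeriodicDerivs q (a j)) :
    ∃ B : ℝ, 0 ≤ B ∧ ∀ K : ℕ, 2 ≤ K → ∀ x : EuclideanSpace ℝ (Fin n), ∀ t ∈ period,
      |(a 0 t - lhs a x t) - slackPartialSum a K x t|
        ≤ B * (1 + ‖x‖) * (Real.log K / (K : ℝ) ^ (q + 1)) := by
  choose b hb0 hb using fun j => (hsmooth j).exists_abs_sub_partialSum_le (hper j)
  have hs0 : 0 ≤ ∑ j : Fin n, b j.succ := sum_nonneg fun j _ => hb0 _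
  refine ⟨b 0 + ∑ j : Fin n, b j.succ, add_nonneg (hb0 0) hs0, fun K hK x t ht => ?_⟩
  set η := Real.log K / (K : ℝ) ^ (q + 1) with hη
  have hη0 : 0 ≤ η := div_nonneg (Real.log_natCast_nonneg K) (by positivity)
  have hsum : |∑ j : Fin n, (a j.succ t - partialSum (a j.succ) K t) * x j|
      ≤ (∑ j : Fin n, b j.succ) * ‖x‖ * η := by
    refine (abs_sum_le_sum_abs _ _).trans ?_
    rw [sum_mul, sum_mul]
    refine sum_le_sum fun j _ => ?_
    rw [abs_mul]
    calc _ ≤ (b j.succ * η) * ‖x‖ := by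
          refine mul_le_mul (hb _ K hK t ht) ?_ (abs_nonneg _) (mul_nonneg (hb0 _) hη0)
          exact PiLp.norm_apply_le x j
      _ = _ := by ring
  have hsplit : (a 0 t - lhs a x t) - slackPartialSum a K x t
      = (a 0 t - partialSum (a 0) K t)
        - ∑ j : Fin n, (a j.succ t - partialSum (a j.succ) K t) * x j := by
    simp only [sub_mul, sum_sub_distrib, slackPartialSum, lhs]
    ring
  rw [hsplit]
  refine (abs_sub _ _).trans ((add_le_add (hb 0 K hK t ht) hsum).trans ?_)
  have h1 : 0 ≤ (∑ j : Fin n, b j.succ) * η := mul_nonneg hs0 hη0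
  have h2 : 0 ≤ b 0 * ‖x‖ * η := mul_nonneg (mul_nonneg (hb0 0) (norm_nonneg _)) hη0
  linarith

lemma tendsto_log_div_pow (q : ℕ) :
    Tendsto (fun K : ℕ => Real.log K / (K : ℝ) ^ (q + 1)) atTop (nhds 0) := by
  have h : Tendsto (fun x : ℝ => Real.log x / x ^ (q + 1)) atTop (nhds 0) := by
    have := (isLittleO_log_rpow_atTop (r := ((q + 1 : ℕ) : ℝ)) (by positivity)).tendsto_div_nhds_zero
    simpa only [Real.rpow_natCast] using this
  exact h.comp tendsto_natCast_atTop_atTop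

end TrigSIP

theorem corollary1 {n : ℕ} (q : ℕ) (a : Fin (n + 1) → ℝ → ℝ) (c : Fin n → ℝ)
    (hsmooth : ∀ j, TrigSIP.HasLipschitzDeriv q (a j))
    (hper : ∀ j, TrigSIP.PeriodicDerivs q (a j))
    (hslater : ∃ xhat : EuclideanSpace ℝ (Fin n),
      ∀ t ∈ TrigSIP.period, TrigSIP.lhs a xhat t < a 0 t)
    (hneg : ∃ xtilde : EuclideanSpace ℝ (Fin n), ∃ Q : ℝ, Q < 0 ∧
      ∀ t ∈ TrigSIP.period, TrigSIP.lhs a xtilde t ≤ Q)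
    (hc : c ≠ 0)
    (hne : (TrigSIP.solP a c).Nonempty)
    (hbdd : ∃ R : ℝ, ∀ x ∈ TrigSIP.solP a c, ‖x‖ ≤ R) :
    ∃ L : ℝ, 0 < L ∧ ∃ K₀ : ℕ, ∀ K : ℕ, K₀ ≤ K →
      ∀ x Y, (x, Y) ∈ TrigSIP.solTFP a c K →
        TrigSIP.IsApproxOptimal a c L (Real.log K / (K : ℝ) ^ (q + 1)) x := by
  open TrigSIP in
  obtain ⟨d, Q, hQ, hd⟩ := hneg
  obtain ⟨x₀, hx₀⟩ := hne
  obtain ⟨R, hR⟩ := hbdd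
  obtain ⟨κ, r, hκ, hr, hgrowth⟩ := exists_linear_growth hx₀ hR
  obtain ⟨B, hB0, hB⟩ := exists_abs_slack_sub_le hsmooth hper
  obtain ⟨S, rfl⟩ : ∃ S, Q = -S := ⟨-Q, by ring⟩
  have hS : 0 < S := by linarith
  set v := |cost c d| with hv
  have hv0 : 0 ≤ v := abs_nonneg _
  have hvd : cost c d ≤ v := le_abs_self _
  set w := ‖d‖ with hw
  have hw0 : 0 ≤ w := norm_nonneg _
  -- `A η` and `D η` are the steps along `d` that repair feasibility for the truncated program,
  -- starting from `x₀`, and for the original one, starting from any point of norm at most `ρ`.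
  set A := B * (1 + ‖x₀‖ + w) / S with hA
  have hA0 : 0 ≤ A := by positivity
  set ρ := 2 * (‖x₀‖ + r) + 3 with hρ
  have hρ0 : 0 ≤ ρ := by positivity
  set D := B * (1 + ρ) / S with hD
  have hD0 : 0 ≤ D := by positivity
  refine ⟨A * v + D * v + D * w + 1, by positivity, ?_⟩
  have hlim := tendsto_log_div_pow q
  have ev : ∀ M : ℝ, ∀ ε > 0, ∀ᶠ K : ℕ in Filter.atTop,
      M * (Real.log K / (K : ℝ) ^ (q + 1)) < ε := by
    intro M ε hε
    have := hlim.const_mul M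
    rw [mul_zero] at this
    exact this.eventually_lt_const hε
  obtain ⟨K₀, hK₀⟩ := Filter.eventually_atTop.1 ((ev A 1 one_pos).and
    ((ev (A * v / κ) 1 one_pos).and ((ev (B / S * (v / κ + w)) (1 / 2) (by norm_num)).and
      (Filter.eventually_ge_atTop 2))))
  refine ⟨K₀, fun K hK x Y hxY => ?_⟩
  obtain ⟨hη1, hη2, hη3, hK2⟩ := hK₀ K hK
  have hBK := hB K hK2
  set η := Real.log K / (K : ℝ) ^ (q + 1) with hη
  have hη0 : 0 ≤ η := div_nonneg (Real.log_natCast_nonneg K) (by positivity)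
  have hval := valP_eq hx₀
  -- The optimal value of the truncated program is not much larger than `v(P)`.
  have hupper : cost c x ≤ cost c x₀ + A * η * v := by
    obtain ⟨Y', hY'⟩ := (exists_mem_feasTFP_iff a K (x₀ + (A * η) • d)).2
      (slackPartialSum_nonneg_of_period fun t ht => by
        have h1 := abs_le.1 (hBK (x₀ + (A * η) • d) t ht)
        have h2 := hx₀.1 t ht
        have h3 := hd t ht
        rw [lhs_add_smul] at h1
        have h4 : ‖x₀ + (A * η) • d‖ ≤ ‖x₀‖ + w := by
          refine (norm_add_le _ _).trans ?_
          rw [norm_smul, Real.norm_of_nonneg (by positivity)]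
          have := mul_le_mul_of_nonneg_right hη1.le hw0
          linarith
        have h5 : B * (1 + ‖x₀ + (A * η) • d‖) * η ≤ A * η * S := by
          have : A * η * S = B * (1 + ‖x₀‖ + w) * η := by rw [hA]; field_simp
          rw [this]
          exact mul_le_mul_of_nonneg_right (mul_le_mul_of_nonneg_left (by linarith) hB0) hη0
        have h6 : A * η * lhs a d t ≤ A * η * -S := mul_le_mul_of_nonneg_left h3 (by positivity)
        linarith [h1.2])
    have h1 := hxY.2 _ hY'
    simp only [cost_add_smul] at h1
    have h2 : A * η * cost c d ≤ A * η * v := mul_le_mul_of_nonneg_left hvd (by positivity)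
    linarith
  have hslack := (exists_mem_feasTFP_iff a K x).1 ⟨Y, hxY.1⟩
  set δ := B * (1 + ‖x‖) * η / S with hδ
  have hδ0 : 0 ≤ δ := by positivity
  have hfeas : x + δ • d ∈ feasP a := by
    intro t ht
    have h1 := abs_le.1 (hBK x t ht)
    have h2 := hslack t
    have h3 := mul_le_mul_of_nonneg_left (hd t ht) hδ0
    have h4 : δ * S = B * (1 + ‖x‖) * η := by rw [hδ]; field_simp
    rw [lhs_add_smul]
    linarith [h1.1]
  have hcost : cost c (x + δ • d) ≤ cost c x + δ * v := by
    rw [cost_add_smul]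
    have := mul_le_mul_of_nonneg_left hvd hδ0
    linarith
  -- Linear growth of the objective bounds `x` independently of `K`.
  have hdist : ‖x + δ • d - x₀‖ ≤ r + 1 + δ * (v / κ) := by
    rcases le_total ‖x + δ • d - x₀‖ r with h | h
    · have : 0 ≤ δ * (v / κ) := by positivity
      linarith
    · have h1 := hgrowth _ hfeas h
      have h2 : ‖x + δ • d - x₀‖ ≤ (A * η * v + δ * v) / κ := by
        rw [le_div_iff₀ hκ]
        linarith
      have h3 : (A * η * v + δ * v) / κ = A * v / κ * η + δ * (v / κ) := by ring
      linarith
  have hxbd : ‖x‖ ≤ ρ := by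
    have h1 : ‖x‖ ≤ ‖x + δ • d - x₀‖ + ‖x₀‖ + δ * w := by
      have e : x = (x + δ • d - x₀) + x₀ - δ • d := by abel
      calc ‖x‖ = ‖(x + δ • d - x₀) + x₀ - δ • d‖ := by rw [← e]
        _ ≤ ‖(x + δ • d - x₀) + x₀‖ + ‖δ • d‖ := norm_sub_le _ _
        _ ≤ _ := by
          rw [norm_smul, Real.norm_of_nonneg hδ0]
          gcongr
          exact norm_add_le _ _
    have h2 : δ * (v / κ) + δ * w ≤ 1 / 2 * (1 + ‖x‖) := by
      have : δ * (v / κ) + δ * w = B / S * (v / κ + w) * η * (1 + ‖x‖) := by rw [hδ]; ring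
      rw [this]
      gcongr
    linarith
  have hδD : δ ≤ D * η := by
    have : D * η = B * (1 + ρ) * η / S := by rw [hD]; ring
    rw [this, hδ]
    gcongr
  have hAv : 0 ≤ A * v * η := by positivity
  have hDv : 0 ≤ D * v * η := by positivity
  have hDw : 0 ≤ D * w * η := by positivity
  have hL : (A * v + D * v + D * w + 1) * η = A * v * η + D * v * η + D * w * η + η := by ring
  refine ⟨?_, ?_⟩
  · rw [hval, hL, abs_le]
    have h1 := hx₀.2 _ hfeas
    have h2 := mul_le_mul_of_nonneg_right hδD hv0
    constructor <;> linarith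
  · rw [hL]
    have h1 := Metric.infDist_le_dist_of_mem (x := x) hfeas
    have h2 : dist x (x + δ • d) = δ * w := by
      rw [dist_eq_norm, sub_add_cancel_left, norm_neg, norm_smul, Real.norm_of_nonneg hδ0]
    have h3 := mul_le_mul_of_nonneg_right hδD hw0
    linarith
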